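/- Work in a set theory with sets and classes; a category has a class of objects and classes of morphisms, and $\mathbf{CAT}$ is the 2-category of categories, functors and natural transformations. For a regular cardinal $\lambda$, a category is $\lambda$-accessible if it is locally small, has $\lambda$-directed colimits, and has a set $\mathcal A$ of $\lambda$-presentable objects such that every object is a $\lambda$-directed colimit of objects from $\mathcal A$; it is accessible if it is $\lambda$-accessible for some $\lambda$. A functor between accessible categories is accessible if it preserves $\lambda$-directed colimits for some regular $\lambda$. Let $\mathbf{Acc}$ be the 2-category of accessible categories, accessible functors and all natural transformations. Let $\mathbf{Acc}_0$ be the 2-category of accessible categories having all directed colimits (colimits indexed by nonempty directed posets that are sets), functors preserving directed colimits, and all natural transformations. For functors $F,G:\mathcal K\to\mathcal L$, let $\mathrm{Ins}(F,G)$ be the category whose objects are pairs $(K, f:FK\to GK)$ and whose morphisms $(K,f)\to(K',f')$ are the morphisms $k:K\to K'$ with $G(k)f=f'F(k)$, let $P:\mathrm{Ins}(F,G)\to\mathcal K$ be the projection $(K,f)\mapsto K$, and let $\varphi:FP\to GP$ be given by $\varphi_{(K,f)}=f$. For natural transformations $\varphi,\psi:F\to G$, let $\mathrm{Eq}(\varphi,\psi)$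 be the full subcategory of $\mathcal K$ on the objects $K$ with $\varphi_K=\psi_K$, with its inclusion into $\mathcal K$. A product, inserter or equifier in a sub-2-category $\mathbf S$ of $\mathbf{CAT}$ that contains all 2-cells between its 1-cells is a cone (object, projection 1-cells and, for inserters, the 2-cell) lying in $\mathbf S$ with the corresponding strict universal property, one- and two-dimensional, with respect to the objects, 1-cells and 2-cells of $\mathbf S$. **Theorem.** $\mathbf{Acc}_0$ is closed under PIE-limits (products of families indexed by a set, inserters, equifiers) in $\mathbf{Acc}$: it is a sub-2-category of $\mathbf{Acc}$, every product, inserter or equifier diagram in $\mathbf{Acc}_0$ has a limit in $\mathbf{Acc}$, and every such limit in $\mathbf{Acc}$ is also a limit in $\mathbf{Acc}_0$. Moreover these limits are calculated in $\mathbf{CAT}$: for a set-indexed family $(\mathcal K_i)_{i\in I}$ of objects of $\mathbf{Acc}_0$, for 1-cells $F,G:\mathcal K\to\mathcal L$ of $\mathbf{Acc}_0$, and for natural transformations $\varphi,\psi:F\to G$, the product category $\prod_i\mathcal K_i$, the category $\mathrm{Ins}(F,G)$ and the category $\mathrm{Eq}(\varphi,\psi)$, with their projections (and the natural transformation $FP\to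 GP$ in the case of $\mathrm{Ins}(F,G)$), are respectively a product, an inserter and an equifier in $\mathbf{CAT}$, in $\mathbf{Acc}$ and in $\mathbf{Acc}_0$. In particular these categories are accessible and have directed colimits, and their projections preserve directed colimits. -/

import Mathlib

open CategoryTheory Limits Bicategory

universe w v₁ v₂ u₁ u₂

namespace PIE

/-! ### Locally full sub-2-categories and PIE-limits in them -/

/-- A locally full sub-2-category of `B`: some objects, some 1-cells (closed under identities
and composition), and all 2-cells between those. -/
structure Sub2Cat (B : Type u₁) [Bicategory.{u₂, v₁} B] where
  /-- the objects -/
  obj : B → Prop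
  /-- the 1-cells; only those between objects satisfying `obj` matter -/
  hom : ∀ {X Y : B}, (X ⟶ Y) → Prop
  id_mem : ∀ X : B, obj X → hom (𝟙 X)
  comp_mem : ∀ {X Y Z : B} (f : X ⟶ Y) (g : Y ⟶ Z), hom f → hom g → hom (f ≫ g)

namespace Sub2Cat

variable {B : Type u₁} [Bicategory.{u₂, v₁} B]

/-- The whole 2-category. -/
def whole (B : Type u₁) [Bicategory.{u₂, v₁} B] : Sub2Cat B where
  obj _ := True
  hom _ := True
  id_mem _ _ := trivial
  comp_mem _ _ _ _ := trivial

/-- `S` is contained in `T`. -/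
def IsContainedIn (S T : Sub2Cat B) : Prop :=
  (∀ X : B, S.obj X → T.obj X) ∧
    ∀ (X Y : B) (f : X ⟶ Y), S.obj X → S.obj Y → S.hom f → T.hom f

/-- `(P, π)` is a (strict, 2-dimensional) product of the family `K` in the 2-category `S`. -/
structure IsProduct (S : Sub2Cat B) {I : Type w} (K : I → B) (P : B) (π : ∀ i, P ⟶ K i) :
    Prop where
  obj_mem : S.obj P
  proj_mem : ∀ i, S.hom (π i)
  /-- one-dimensional universal property -/
  existsUnique_hom : ∀ (T : B), S.obj T → ∀ q : ∀ i, T ⟶ K i, (∀ i, S.hom (q i)) →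
    ∃! h : T ⟶ P, S.hom h ∧ ∀ i, h ≫ π i = q i
  /-- two-dimensional universal property -/
  existsUnique_cell : ∀ (T : B), S.obj T → ∀ h h' : T ⟶ P, S.hom h → S.hom h' →
    ∀ α : ∀ i, h ≫ π i ⟶ h' ≫ π i, ∃! β : h ⟶ h', ∀ i, β ▷ π i = α i

/-- The 2-cell `(h ≫ p) ≫ F ⟶ (h ≫ p) ≫ G` obtained by restricting `φ : p ≫ F ⟶ p ≫ G`
along `h`. -/
def restrict {T P X Y : B} (h : T ⟶ P) {p : P ⟶ X} {F G : X ⟶ Y} (φ : p ≫ F ⟶ p ≫ G) :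
    (h ≫ p) ≫ F ⟶ (h ≫ p) ≫ G :=
  (α_ h p F).hom ≫ h ◁ φ ≫ (α_ h p G).inv

/-- `(P, p, φ)` is a (strict, 2-dimensional) inserter of `F` and `G` in the 2-category `S`.
In the one-dimensional property, the displayed equation of 2-cells says that `φ` restricted
along `h` is `ψ`; the cells `eqToHom e` are the identity 2-cells along `e : h ≫ p = H`. -/
structure IsInserter (S : Sub2Cat B) {X Y : B} (F G : X ⟶ Y) (P : B) (p : P ⟶ X)
    (φ : p ≫ F ⟶ p ≫ G) : Prop where
  obj_mem : S.obj P
  proj_mem : S.hom p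
  /-- one-dimensional universal property -/
  existsUnique_hom : ∀ (T : B), S.obj T → ∀ H : T ⟶ X, S.hom H → ∀ ψ : H ≫ F ⟶ H ≫ G,
    ∃! h : T ⟶ P, S.hom h ∧ ∃ e : h ≫ p = H,
      restrict h φ ≫ eqToHom e ▷ G = eqToHom e ▷ F ≫ ψ
  /-- two-dimensional universal property -/
  existsUnique_cell : ∀ (T : B), S.obj T → ∀ h h' : T ⟶ P, S.hom h → S.hom h' →
    ∀ β : h ≫ p ⟶ h' ≫ p, restrict h φ ≫ β ▷ G = β ▷ F ≫ restrict h' φ →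
      ∃! γ : h ⟶ h', γ ▷ p = β

/-- `(P, p)` is a (strict, 2-dimensional) equifier of `φ` and `ψ` in the 2-category `S`. -/
structure IsEquifier (S : Sub2Cat B) {X Y : B} {F G : X ⟶ Y} (φ ψ : F ⟶ G) (P : B) (p : P ⟶ X) :
    Prop where
  obj_mem : S.obj P
  proj_mem : S.hom p
  condition : p ◁ φ = p ◁ ψ
  /-- one-dimensional universal property -/
  existsUnique_hom : ∀ (T : B), S.obj T → ∀ H : T ⟶ X, S.hom H → H ◁ φ = H ◁ ψ →
    ∃! h : T ⟶ P, S.hom h ∧ h ≫ p = H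
  /-- two-dimensional universal property -/
  existsUnique_cell : ∀ (T : B), S.obj T → ∀ h h' : T ⟶ P, S.hom h → S.hom h' →
    ∀ β : h ≫ p ⟶ h' ≫ p, ∃! γ : h ⟶ h', γ ▷ p = β

/-- `S` is closed under (`w`-small) products in `T`: families of objects of `S` have a product
in `T`, and every such product is a product in `S`. -/
def ClosedUnderProducts (S T : Sub2Cat B) : Prop :=
  ∀ (I : Type w) (K : I → B), (∀ i, S.obj (K i)) →
    (∃ (P : B) (π : ∀ i, P ⟶ K i), T.IsProduct K P π) ∧
      ∀ (P : B) (π : ∀ i, P ⟶ K i), T.IsProduct K P π → S.IsProduct K P π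

/-- `S` is closed under inserters in `T`. -/
def ClosedUnderInserters (S T : Sub2Cat B) : Prop :=
  ∀ (X Y : B) (F G : X ⟶ Y), S.obj X → S.obj Y → S.hom F → S.hom G →
    (∃ (P : B) (p : P ⟶ X) (φ : p ≫ F ⟶ p ≫ G), T.IsInserter F G P p φ) ∧
      ∀ (P : B) (p : P ⟶ X) (φ : p ≫ F ⟶ p ≫ G), T.IsInserter F G P p φ → S.IsInserter F G P p φ

/-- `S` is closed under equifiers in `T`. -/
def ClosedUnderEquifiers (S T : Sub2Cat B) : Prop :=
  ∀ (X Y : B) (F G : X ⟶ Y) (φ ψ : F ⟶ G), S.obj X → S.obj Y → S.hom F → S.hom G →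
    (∃ (P : B) (p : P ⟶ X), T.IsEquifier φ ψ P p) ∧
      ∀ (P : B) (p : P ⟶ X), T.IsEquifier φ ψ P p → S.IsEquifier φ ψ P p

/-- `S` is a sub-2-category of `T` closed under PIE-limits (products of `w`-small families,
inserters, equifiers). -/
def ClosedUnderPIELimits (S T : Sub2Cat B) : Prop :=
  S.IsContainedIn T ∧ ClosedUnderProducts.{w} S T ∧ ClosedUnderInserters S T ∧
    ClosedUnderEquifiers S T

end Sub2Cat

/-! ### Directed colimits -/

/-- `C` has colimits indexed by `w`-small (nonempty) directed posets. -/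
def HasDirectedColimits (C : Type u₁) [Category.{v₁} C] : Prop :=
  ∀ (J : Type w) [PartialOrder J] [IsDirectedOrder J] [Nonempty J], HasColimitsOfShape J C

/-- `F` preserves colimits indexed by `w`-small (nonempty) directed posets. -/
def PreservesDirectedColimits {C : Type u₁} [Category.{v₁} C] {D : Type u₂} [Category.{v₂} D]
    (F : C ⥤ D) : Prop :=
  ∀ (J : Type w) [PartialOrder J] [IsDirectedOrder J] [Nonempty J], PreservesColimitsOfShape J F

/-! ### The 2-categories of accessible categories -/

/-- The 2-category of all categories, in a set theory with sets and classes: "set" means `w`-small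
type and "class" means type in `Type (w + 1)`. A category has a class of objects and classes of
morphisms; accessible categories have, by definition, morphism classes equivalent to sets. -/
abbrev CAT : Type (w + 2) := Cat.{w + 1, w + 1}

/-- Accessible categories, accessible functors, all natural transformations. -/
def Acc : Sub2Cat CAT.{w} where
  obj C := IsAccessibleCategory.{w} C
  hom F := Functor.IsAccessible.{w} F.toFunctor
  id_mem C _ := by
    have : Fact Cardinal.aleph0.{w}.IsRegular := Cardinal.fact_isRegular_aleph0
    exact ⟨Cardinal.aleph0, this, inferInstanceAs ((𝟭 C).IsCardinalAccessible _)⟩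
  comp_mem F G hF hG := by
    have := hF
    have := hG
    exact inferInstanceAs (Functor.IsAccessible.{w} (F.toFunctor ⋙ G.toFunctor))

/-- Accessible categories with directed colimits, functors preserving directed colimits,
all natural transformations. -/
def Acc₀ : Sub2Cat CAT.{w} where
  obj C := IsAccessibleCategory.{w} C ∧ HasDirectedColimits.{w} C
  hom F := PreservesDirectedColimits.{w} F.toFunctor
  id_mem C _ J _ _ _ := inferInstanceAs (PreservesColimitsOfShape J (𝟭 C))
  comp_mem F G hF hG J _ _ _ := by
    have := hF J
    have := hG J
    exact inferInstanceAs (PreservesColimitsOfShape J (F.toFunctor ⋙ G.toFunctor))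

/-! ### Inserter and equifier categories -/

section Inserter

variable {C : Type u₁} [Category.{v₁} C] {D : Type u₂} [Category.{v₂} D]

/-- An object of the inserter category of `F` and `G`: an object `base` with a morphism
`F base ⟶ G base`. -/
structure Ins (F G : C ⥤ D) where
  /-- the underlying object -/
  base : C
  /-- the structure morphism -/
  str : F.obj base ⟶ G.obj base

namespace Ins

variable {F G : C ⥤ D}

/-- A morphism `k` of underlying objects making the square with sides `F k`, `G k` commute. -/
@[ext]
structure Hom (A B : Ins F G) where
  /-- the underlying morphism -/
  base : A.base ⟶ B.base
  w : A.str ≫ G.map base = F.map base ≫ B.str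

instance : Category (Ins F G) where
  Hom A B := Hom A B
  id A := ⟨𝟙 A.base, by simp⟩
  comp f g := ⟨f.base ≫ g.base, by
    rw [G.map_comp, F.map_comp, ← Category.assoc, f.w, Category.assoc, g.w, Category.assoc]⟩

variable (F G) in
/-- The projection functor. -/
def proj : Ins F G ⥤ C where
  obj A := A.base
  map f := Hom.base f

variable (F G) in
/-- The universal natural transformation, whose component at an object is its structure
morphism. -/
def cell : proj F G ⋙ F ⟶ proj F G ⋙ G where
  app A := A.str
  naturality _ _ f := (Hom.w f).symm

end Ins

/-- The equifier category of `φ` and `ψ`: the full subcategory of the objects at which `φ` and `ψ`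
agree. -/
abbrev Eqf {F G : C ⥤ D} (φ ψ : F ⟶ G) :=
  ObjectProperty.FullSubcategory fun X : C => φ.app X = ψ.app X

/-- The inclusion of the equifier category. -/
abbrev Eqf.incl {F G : C ⥤ D} (φ ψ : F ⟶ G) : Eqf φ ψ ⥤ C :=
  ObjectProperty.ι _

end Inserter

/-! ### The same constructions inside the 2-category of categories -/

/-- The product category. -/
def prodCat {I : Type w} (K : I → CAT.{w}) : CAT.{w} :=
  Cat.of (∀ i, K i)

/-- The projections of the product category. -/
def prodProj {I : Type w} (K : I → CAT.{w}) (i : I) : prodCat K ⟶ K i :=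
  .ofFunctor (Pi.eval (fun i => (K i : Type _)) i)

/-- The inserter category. -/
def insCat {X Y : CAT.{w}} (F G : X ⟶ Y) : CAT.{w} :=
  Cat.of (Ins F.toFunctor G.toFunctor)

/-- The projection of the inserter category. -/
def insProj {X Y : CAT.{w}} (F G : X ⟶ Y) : insCat F G ⟶ X :=
  .ofFunctor (Ins.proj F.toFunctor G.toFunctor)

/-- The universal 2-cell of the inserter category. -/
def insCell {X Y : CAT.{w}} (F G : X ⟶ Y) : insProj F G ≫ F ⟶ insProj F G ≫ G :=
  .ofNatTrans (Ins.cell F.toFunctor G.toFunctor)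

/-- The equifier category. -/
def eqfCat {X Y : CAT.{w}} {F G : X ⟶ Y} (φ ψ : F ⟶ G) : CAT.{w} :=
  Cat.of (Eqf φ.toNatTrans ψ.toNatTrans)

/-- The inclusion of the equifier category. -/
def eqfIncl {X Y : CAT.{w}} {F G : X ⟶ Y} (φ ψ : F ⟶ G) : eqfCat φ ψ ⟶ X :=
  .ofFunctor (Eqf.incl φ.toNatTrans ψ.toNatTrans)

end PIE

namespace PIE

/-! ### Universal properties of the canonical constructions in the 2-category of categories -/

/-! In `CAT` the three universal properties hold by inspection. They restrict to a sub-2-category as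
soon as the limit object and the projections lie in it and the projections detect its 1-cells
(`of_isContainedIn`). Detection and the existence of directed colimits come from the way colimits
are formed: componentwise in a product; in an inserter, on the base, as soon as `F` preserves them;
in an equifier, as in `C`. An arbitrary limit in `Acc` is isomorphic to the canonical one, and
`Acc₀` is closed under isomorphism in `Acc` (`of_isReplete`).

The substance is that the three categories are accessible. Directed colimits allow the index of
accessibility to be raised to every sufficiently large regular `μ`: if an object is a directed
colimit over a poset `I`, the directed subsets of `I` of size `< μ` form a `μ`-directed family, and
the object is the colimit of the subcolimits over them
(`directedColimits_isCardinalFilteredGenerator`). If `F` preserves directed colimits, this also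
gives, for large `μ`, a generator of `μ`-presentable objects with `μ`-presentable image under `F`
(`exists_presentableWithImage_generator`).

For an inserter object `(X, f)`, write `X` as a `μ`-directed colimit of such objects `K i`.
Presentability of `F (K i)` factors `f` on `F (K i)` through some `G (K (s i))`, with compatibility
along `i ⟶ j` visible at a stage `t i j`. On a subset closed under `s`, `t` and a choice of upper
bounds, `f` is therefore induced by a structure morphism on the subcolimit. Closed subsets of size
`< μ` are still cofinal, because `μ` is regular and uncountable, so `(X, f)` is the `μ`-directed
colimit of these small pieces. For equifiers, `s i` is a stage at which the two transformations
agree on `K i`. For products, one `μ` exceeding `I` and serving all factors is chosen, and product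
index categories are used. -/

theorem isProduct_prodCat {I : Type w} (K : I → CAT.{w}) :
    (Sub2Cat.whole _).IsProduct K (prodCat K) (prodProj K) where
  obj_mem := trivial
  proj_mem _ := trivial
  existsUnique_hom T _ q _ := by
    refine ⟨.ofFunctor (Functor.pi' fun i => (q i).toFunctor), ⟨trivial, fun i => rfl⟩, ?_⟩
    rintro h ⟨-, hh⟩
    obtain rfl : (fun i => h ≫ prodProj K i) = q := funext hh
    rfl
  existsUnique_cell T _ h h' _ _ α := by
    refine ⟨.ofNatTrans
      { app := fun x i => (α i).toNatTrans.app x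
        naturality := fun x y f => funext fun i => (α i).toNatTrans.naturality f },
      fun i => rfl, ?_⟩
    intro β hβ
    obtain rfl : (fun i => β ▷ prodProj K i) = α := funext hβ
    rfl

/-- The functor to the inserter category given by a functor and a natural transformation. -/
def Ins.lift {C : Type u₁} [Category.{v₁} C] {D : Type u₂} [Category.{v₂} D] {F G : C ⥤ D}
    {T : Type*} [Category* T] (H : T ⥤ C) (ψ : H ⋙ F ⟶ H ⋙ G) : T ⥤ Ins F G where
  obj x := ⟨H.obj x, ψ.app x⟩
  map f := ⟨H.map f, (ψ.naturality f).symm⟩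
  map_id _ := Ins.Hom.ext (H.map_id _)
  map_comp _ _ := Ins.Hom.ext (H.map_comp _ _)

namespace Sub2Cat

/-- `h` is a lift of `(H, ψ)` along `(p, φ)`, as in the one-dimensional universal property of
inserters. -/
def IsLift {B : Type u₁} [Bicategory.{u₂, v₁} B] {T P X Y : B} {F G : X ⟶ Y} {p : P ⟶ X}
    (φ : p ≫ F ⟶ p ≫ G) {H : T ⟶ X} (ψ : H ≫ F ⟶ H ≫ G) (h : T ⟶ P) : Prop :=
  ∃ e : h ≫ p = H, restrict h φ ≫ eqToHom e ▷ G = eqToHom e ▷ F ≫ ψ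

/-- Once the equation of 1-cells is substituted, the `eqToHom` cells are identities; every lifting
equation below is brought to this form. -/
theorem isLift_comp_iff {B : Type u₁} [Bicategory.{u₂, v₁} B] {T P X Y : B} {F G : X ⟶ Y}
    {p : P ⟶ X} {φ : p ≫ F ⟶ p ≫ G} {h : T ⟶ P} {ψ : (h ≫ p) ≫ F ⟶ (h ≫ p) ≫ G} :
    IsLift φ ψ h ↔ restrict h φ = ψ :=
  ⟨fun ⟨_, he⟩ => by simpa using he, fun h => ⟨rfl, by simp [h]⟩⟩

theorem restrict_app {T P X Y : CAT.{w}} (h : T ⟶ P) {p : P ⟶ X} {F G : X ⟶ Y}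
    (φ : p ≫ F ⟶ p ≫ G) (x : T) :
    (restrict h φ).toNatTrans.app x = φ.toNatTrans.app (h.toFunctor.obj x) := by
  simp [restrict]

theorem restrict_eq_iff {T P X Y : CAT.{w}} {h : T ⟶ P} {p : P ⟶ X} {F G : X ⟶ Y}
    {φ : p ≫ F ⟶ p ≫ G} {ψ : (h ≫ p) ≫ F ⟶ (h ≫ p) ≫ G} :
    restrict h φ = ψ ↔ ∀ x : T, φ.toNatTrans.app (h.toFunctor.obj x) = ψ.toNatTrans.app x := by
  refine ⟨fun e x => by rw [← e, restrict_app], fun e => ?_⟩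
  ext x
  rw [restrict_app, e]

theorem IsLift.comp {T P P' X Y : CAT.{w}} {F G : X ⟶ Y} {p : P ⟶ X} {φ : p ≫ F ⟶ p ≫ G}
    {p' : P' ⟶ X} {φ' : p' ≫ F ⟶ p' ≫ G} {H : T ⟶ X} {ψ : H ≫ F ⟶ H ≫ G}
    {h : T ⟶ P} {k : P ⟶ P'} (hh : IsLift φ ψ h) (hk : IsLift φ' φ k) :
    IsLift φ' ψ (h ≫ k) := by
  -- `id` keeps `hk` available while its equation of 1-cells is substituted.
  obtain ⟨rfl, -⟩ := id hk
  obtain ⟨rfl, -⟩ := id hh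
  rw [isLift_comp_iff, restrict_eq_iff] at hh hk
  exact isLift_comp_iff.2 (restrict_eq_iff.2 fun x => (hk _).trans (hh x))

theorem IsLift.id {P X Y : CAT.{w}} {F G : X ⟶ Y} {p : P ⟶ X} (φ : p ≫ F ⟶ p ≫ G) :
    IsLift φ φ (𝟙 P) :=
  (isLift_comp_iff (h := 𝟙 P) (p := p)).2 (restrict_eq_iff.2 fun _ => rfl)

end Sub2Cat

theorem isInserter_insCat {X Y : CAT.{w}} (F G : X ⟶ Y) :
    (Sub2Cat.whole _).IsInserter F G (insCat F G) (insProj F G) (insCell F G) where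
  obj_mem := trivial
  proj_mem := trivial
  existsUnique_hom T _ H _ ψ := by
    refine ⟨.ofFunctor (Ins.lift H.toFunctor ψ.toNatTrans), ⟨trivial, ?_⟩, ?_⟩
    · exact Sub2Cat.isLift_comp_iff (p := insProj F G)
        (h := .ofFunctor (Ins.lift H.toFunctor ψ.toNatTrans)).2
        (Sub2Cat.restrict_eq_iff.2 fun _ => rfl)
    · rintro h ⟨-, hh⟩
      obtain ⟨rfl, -⟩ := id hh
      have := Sub2Cat.isLift_comp_iff.1 hh
      obtain rfl :
          .ofNatTrans (h.toFunctor.whiskerLeft (Ins.cell F.toFunctor G.toFunctor)) = ψ := by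
        ext x
        exact Sub2Cat.restrict_eq_iff.1 this x
      rfl
  existsUnique_cell T _ h h' _ _ β hβ := by
    refine ⟨.ofNatTrans
      { app := fun x => ⟨β.toNatTrans.app x, ?_⟩
        naturality := fun x y f => Ins.Hom.ext (β.toNatTrans.naturality f) },
      rfl, ?_⟩
    · have h₁ : (Sub2Cat.restrict h (insCell F G) ≫ β ▷ G).toNatTrans.app x =
        (β ▷ F ≫ Sub2Cat.restrict h' (insCell F G)).toNatTrans.app x := by rw [hβ]
      rwa [Cat.Hom₂.comp_app, Cat.Hom₂.comp_app, Sub2Cat.restrict_app, Sub2Cat.restrict_app]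
        at h₁
    · intro γ hγ
      subst hγ
      rfl

theorem isEquifier_eqfCat {X Y : CAT.{w}} {F G : X ⟶ Y} (φ ψ : F ⟶ G) :
    (Sub2Cat.whole _).IsEquifier φ ψ (eqfCat φ ψ) (eqfIncl φ ψ) where
  obj_mem := trivial
  proj_mem := trivial
  condition := by
    ext x
    exact x.property
  existsUnique_hom T _ H _ hH := by
    have key (x : T) : φ.toNatTrans.app (H.toFunctor.obj x) =
      ψ.toNatTrans.app (H.toFunctor.obj x) := congr_arg (fun t => t.toNatTrans.app x) hH
    refine ⟨.ofFunctor (ObjectProperty.lift _ H.toFunctor key), ⟨trivial, rfl⟩, ?_⟩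
    rintro h ⟨-, rfl⟩
    rfl
  existsUnique_cell T _ h h' _ _ β := by
    refine ⟨.ofNatTrans
      { app := fun x => ObjectProperty.homMk (β.toNatTrans.app x)
        naturality := fun x y f =>
          ObjectProperty.hom_ext _ (β.toNatTrans.naturality f) }, rfl, ?_⟩
    intro γ hγ
    subst hγ
    rfl

/-! ### Limits in a sub-2-category and in a larger one -/

namespace Sub2Cat

section

variable {B : Type u₁} [Bicategory.{u₂, v₁} B] {S T : Sub2Cat B}

theorem whole_contains (S : Sub2Cat B) : S.IsContainedIn (whole B) :=
  ⟨fun _ _ => trivial, fun _ _ _ _ _ _ => trivial⟩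

/-- A product in `T` whose projections lie in `S` and detect 1-cells of `S` is a product in `S`. -/
theorem IsProduct.of_isContainedIn (hST : S.IsContainedIn T) {I : Type w} {K : I → B}
    (hK : ∀ i, S.obj (K i)) {P : B} {π : ∀ i, P ⟶ K i} (hP : T.IsProduct K P π) (hS : S.obj P)
    (hπ : ∀ i, S.hom (π i))
    (detect : ∀ (X : B) (h : X ⟶ P), S.obj X → T.hom h → (∀ i, S.hom (h ≫ π i)) → S.hom h) :
    S.IsProduct K P π where
  obj_mem := hS
  proj_mem := hπ
  existsUnique_hom X hX q hq := by
    obtain ⟨h, ⟨hT, hh⟩, hu⟩ := hP.existsUnique_hom X (hST.1 _ hX) q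
      fun i => hST.2 _ _ _ hX (hK i) (hq i)
    refine ⟨h, ⟨detect X h hX hT fun i => hh i ▸ hq i, hh⟩, fun h' hh' => hu h' ⟨?_, hh'.2⟩⟩
    exact hST.2 _ _ _ hX hS hh'.1
  existsUnique_cell X hX h h' hh hh' α :=
    hP.existsUnique_cell X (hST.1 _ hX) h h' (hST.2 _ _ _ hX hS hh) (hST.2 _ _ _ hX hS hh') α

/-- An inserter in `T` whose projection lies in `S` and detects 1-cells of `S` is an inserter
in `S`. -/
theorem IsInserter.of_isContainedIn (hST : S.IsContainedIn T) {X Y : B} {F G : X ⟶ Y}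
    (hX : S.obj X) {P : B} {p : P ⟶ X} {φ : p ≫ F ⟶ p ≫ G} (hP : T.IsInserter F G P p φ)
    (hS : S.obj P) (hp : S.hom p)
    (detect : ∀ (Z : B) (h : Z ⟶ P), S.obj Z → T.hom h → S.hom (h ≫ p) → S.hom h) :
    S.IsInserter F G P p φ where
  obj_mem := hS
  proj_mem := hp
  existsUnique_hom Z hZ H hH ψ := by
    obtain ⟨h, ⟨hT, hh⟩, hu⟩ := hP.existsUnique_hom Z (hST.1 _ hZ) H
      (hST.2 _ _ _ hZ hX hH) ψ
    refine ⟨h, ⟨detect Z h hZ hT (hh.1 ▸ hH), hh⟩, fun h' hh' => hu h' ⟨?_, hh'.2⟩⟩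
    exact hST.2 _ _ _ hZ hS hh'.1
  existsUnique_cell Z hZ h h' hh hh' α :=
    hP.existsUnique_cell Z (hST.1 _ hZ) h h' (hST.2 _ _ _ hZ hS hh) (hST.2 _ _ _ hZ hS hh') α

/-- An equifier in `T` whose projection lies in `S` and detects 1-cells of `S` is an equifier
in `S`. -/
theorem IsEquifier.of_isContainedIn (hST : S.IsContainedIn T) {X Y : B} {F G : X ⟶ Y}
    {φ ψ : F ⟶ G} (hX : S.obj X) {P : B} {p : P ⟶ X} (hP : T.IsEquifier φ ψ P p)
    (hS : S.obj P) (hp : S.hom p)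
    (detect : ∀ (Z : B) (h : Z ⟶ P), S.obj Z → T.hom h → S.hom (h ≫ p) → S.hom h) :
    S.IsEquifier φ ψ P p where
  obj_mem := hS
  proj_mem := hp
  condition := hP.condition
  existsUnique_hom Z hZ H hH hψ := by
    obtain ⟨h, ⟨hT, hh⟩, hu⟩ := hP.existsUnique_hom Z (hST.1 _ hZ) H
      (hST.2 _ _ _ hZ hX hH) hψ
    refine ⟨h, ⟨detect Z h hZ hT (hh ▸ hH), hh⟩, fun h' hh' => hu h' ⟨?_, hh'.2⟩⟩
    exact hST.2 _ _ _ hZ hS hh'.1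
  existsUnique_cell Z hZ h h' hh hh' α :=
    hP.existsUnique_cell Z (hST.1 _ hZ) h h' (hST.2 _ _ _ hZ hS hh) (hST.2 _ _ _ hZ hS hh') α

/-- `S` is closed under isomorphisms of objects lying in `T`. -/
def IsReplete (S T : Sub2Cat B) : Prop :=
  ∀ ⦃P Q : B⦄ (e : P ⟶ Q) (e' : Q ⟶ P), T.hom e → T.hom e' → e ≫ e' = 𝟙 P → e' ≫ e = 𝟙 Q →
    S.obj Q → S.obj P ∧ S.hom e ∧ S.hom e'

variable [Bicategory.Strict B]

open Bicategory.Strict in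
-- The strict universal property yields mutually inverse `e`, `e'` compatible with the projections,
-- and repleteness puts them and `P` in `S`. A 1-cell into `P` with projections in `S` is its
-- `S`-lift to `P'` followed by `e'`, hence lies in `S`.
theorem IsProduct.of_isReplete (hST : S.IsContainedIn T) (hr : S.IsReplete T)
    {I : Type w} {K : I → B} (hK : ∀ i, S.obj (K i)) {P P' : B} {π : ∀ i, P ⟶ K i}
    {π' : ∀ i, P' ⟶ K i} (hP : T.IsProduct K P π) (hP' : T.IsProduct K P' π')
    (hS : S.IsProduct K P' π') : S.IsProduct K P π := by
  obtain ⟨e, ⟨he, hπ⟩, -⟩ := hP'.existsUnique_hom P hP.obj_mem π hP.proj_mem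
  obtain ⟨e', ⟨he', hπ'⟩, -⟩ := hP.existsUnique_hom P' hP'.obj_mem π' hP'.proj_mem
  obtain ⟨hSP, hSe, hSe'⟩ := hr e e' he he'
    ((hP.existsUnique_hom P hP.obj_mem π hP.proj_mem).unique
      ⟨T.comp_mem _ _ he he', fun i => by rw [assoc, hπ', hπ]⟩
      ⟨T.id_mem _ hP.obj_mem, fun i => id_comp _⟩)
    ((hP'.existsUnique_hom P' hP'.obj_mem π' hP'.proj_mem).unique
      ⟨T.comp_mem _ _ he' he, fun i => by rw [assoc, hπ, hπ']⟩
      ⟨T.id_mem _ hP'.obj_mem, fun i => id_comp _⟩) hS.obj_mem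
  refine hP.of_isContainedIn hST hK hSP (fun i => hπ i ▸ S.comp_mem _ _ hSe (hS.proj_mem i))
    fun X h hX hT hh => ?_
  obtain ⟨k, ⟨hk, hkπ⟩, -⟩ := hS.existsUnique_hom X hX _ hh
  have hkT := hST.2 _ _ _ hX hS.obj_mem hk
  obtain rfl : k ≫ e' = h := (hP.existsUnique_hom X (hST.1 _ hX) (fun i => h ≫ π i)
    fun i => T.comp_mem _ _ hT (hP.proj_mem i)).unique
      ⟨T.comp_mem _ _ hkT he', fun i => by rw [assoc, hπ', hkπ]⟩ ⟨hT, fun i => rfl⟩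
  exact S.comp_mem _ _ hk hSe'

open Bicategory.Strict in
theorem IsEquifier.of_isReplete (hST : S.IsContainedIn T) (hr : S.IsReplete T)
    {X Y : B} {F G : X ⟶ Y} {φ ψ : F ⟶ G} (hX : S.obj X) {P P' : B} {p : P ⟶ X} {p' : P' ⟶ X}
    (hP : T.IsEquifier φ ψ P p) (hP' : T.IsEquifier φ ψ P' p')
    (hS : S.IsEquifier φ ψ P' p') : S.IsEquifier φ ψ P p := by
  obtain ⟨e, ⟨he, hp⟩, -⟩ := hP'.existsUnique_hom P hP.obj_mem p hP.proj_mem hP.condition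
  obtain ⟨e', ⟨he', hp'⟩, -⟩ := hP.existsUnique_hom P' hP'.obj_mem p' hP'.proj_mem hP'.condition
  obtain ⟨hSP, hSe, hSe'⟩ := hr e e' he he'
    ((hP.existsUnique_hom P hP.obj_mem p hP.proj_mem hP.condition).unique
      ⟨T.comp_mem _ _ he he', by rw [assoc, hp', hp]⟩
      ⟨T.id_mem _ hP.obj_mem, id_comp _⟩)
    ((hP'.existsUnique_hom P' hP'.obj_mem p' hP'.proj_mem hP'.condition).unique
      ⟨T.comp_mem _ _ he' he, by rw [assoc, hp, hp']⟩
      ⟨T.id_mem _ hP'.obj_mem, id_comp _⟩) hS.obj_mem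
  refine hP.of_isContainedIn hST hX hSP (hp ▸ S.comp_mem _ _ hSe hS.proj_mem)
    fun Z h hZ hT hh => ?_
  have hψ : (h ≫ p) ◁ φ = (h ≫ p) ◁ ψ := by simp [comp_whiskerLeft, hP.condition]
  obtain ⟨k, ⟨hk, hkp⟩, -⟩ := hS.existsUnique_hom Z hZ _ hh hψ
  have hkT := hST.2 _ _ _ hZ hS.obj_mem hk
  obtain rfl : k ≫ e' = h := (hP.existsUnique_hom Z (hST.1 _ hZ) (h ≫ p)
    (T.comp_mem _ _ hT hP.proj_mem) hψ).unique
      ⟨T.comp_mem _ _ hkT he', by rw [assoc, hp', hkp]⟩ ⟨hT, rfl⟩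
  exact S.comp_mem _ _ hk hSe'

end

/-- The argument is that for products; working in `CAT` lets lifts be composed by a check on
components (`IsLift.comp`). -/
theorem IsInserter.of_isReplete {S T : Sub2Cat CAT.{w}} (hST : S.IsContainedIn T)
    (hr : S.IsReplete T) {X Y : CAT.{w}} {F G : X ⟶ Y} (hX : S.obj X) {P P' : CAT.{w}}
    {p : P ⟶ X} {φ : p ≫ F ⟶ p ≫ G} {p' : P' ⟶ X} {φ' : p' ≫ F ⟶ p' ≫ G}
    (hP : T.IsInserter F G P p φ) (hP' : T.IsInserter F G P' p' φ')
    (hS : S.IsInserter F G P' p' φ') : S.IsInserter F G P p φ := by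
  obtain ⟨e, ⟨he, hp⟩, -⟩ := hP'.existsUnique_hom P hP.obj_mem p hP.proj_mem φ
  obtain ⟨e', ⟨he', hp'⟩, -⟩ := hP.existsUnique_hom P' hP'.obj_mem p' hP'.proj_mem φ'
  obtain ⟨hSP, hSe, hSe'⟩ := hr e e' he he'
    ((hP.existsUnique_hom P hP.obj_mem p hP.proj_mem φ).unique
      ⟨T.comp_mem _ _ he he', IsLift.comp hp hp'⟩ ⟨T.id_mem _ hP.obj_mem, IsLift.id φ⟩)
    ((hP'.existsUnique_hom P' hP'.obj_mem p' hP'.proj_mem φ').unique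
      ⟨T.comp_mem _ _ he' he, IsLift.comp hp' hp⟩ ⟨T.id_mem _ hP'.obj_mem, IsLift.id φ'⟩)
    hS.obj_mem
  refine hP.of_isContainedIn hST hX hSP (hp.1 ▸ S.comp_mem _ _ hSe hS.proj_mem)
    fun Z h hZ hT hh => ?_
  obtain ⟨k, ⟨hk, hkp⟩, -⟩ := hS.existsUnique_hom Z hZ _ hh (restrict h φ)
  have hkT := hST.2 _ _ _ hZ hS.obj_mem hk
  obtain rfl : k ≫ e' = h := (hP.existsUnique_hom Z (hST.1 _ hZ) (h ≫ p)
    (T.comp_mem _ _ hT hP.proj_mem) (restrict h φ)).unique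
      ⟨T.comp_mem _ _ hkT he', IsLift.comp hkp hp'⟩ ⟨hT, isLift_comp_iff.2 rfl⟩
  exact S.comp_mem _ _ hk hSe'

end Sub2Cat

/-! ### Filtered colimits from directed colimits -/

section

variable {C : Type u₁} [Category.{v₁} C] {D : Type u₂} [Category.{v₂} D]

/-- Every small filtered category receives a final functor from a directed poset. -/
theorem HasDirectedColimits.hasColimitsOfShape (hC : HasDirectedColimits.{w} C) (J : Type w)
    [SmallCategory J] [IsFiltered J] : HasColimitsOfShape J C := by
  obtain ⟨α, _, _, _, F, _⟩ := IsFiltered.exists_directed J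
  have := hC α
  exact Functor.Final.hasColimitsOfShape_of_final F

theorem HasDirectedColimits.hasCardinalFilteredColimits (hC : HasDirectedColimits.{w} C)
    (κ : Cardinal.{w}) [Fact κ.IsRegular] : HasCardinalFilteredColimits.{w} C κ where
  hasColimitsOfShape J _ _ :=
    have := isFiltered_of_isCardinalFiltered J κ
    hC.hasColimitsOfShape J

theorem PreservesDirectedColimits.preservesColimitsOfShape {F : C ⥤ D}
    (hF : PreservesDirectedColimits.{w} F) (J : Type w) [SmallCategory J] [IsFiltered J] :
    PreservesColimitsOfShape J F := by
  obtain ⟨α, _, _, _, G, _⟩ := IsFiltered.exists_directed J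
  have := hF α
  exact Functor.Final.preservesColimitsOfShape_of_final G F

theorem PreservesDirectedColimits.isCardinalAccessible {F : C ⥤ D}
    (hF : PreservesDirectedColimits.{w} F) (κ : Cardinal.{w}) [Fact κ.IsRegular] :
    F.IsCardinalAccessible κ where
  preservesColimitOfShape J _ _ :=
    have := isFiltered_of_isCardinalFiltered J κ
    hF.preservesColimitsOfShape J

theorem PreservesDirectedColimits.isAccessible {F : C ⥤ D}
    (hF : PreservesDirectedColimits.{w} F) : F.IsAccessible.{w} := by
  have : Fact Cardinal.aleph0.{w}.IsRegular := Cardinal.fact_isRegular_aleph0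
  have := hF.isCardinalAccessible Cardinal.aleph0.{w}
  exact F.isAccessible_of_isCardinalAccessible Cardinal.aleph0.{w}

end

/-! ### Small directed subsets of a directed poset -/

section

variable {I : Type w}

/-- The nonempty subsets of cardinality `< μ` closed under some binary operations. -/
def closedSubsets (μ : Cardinal.{w}) (ops : Set (I → I → I)) : Set (Set I) :=
  {B | B.Nonempty ∧ HasCardinalLT B μ ∧ ∀ o ∈ ops, ∀ i ∈ B, ∀ j ∈ B, o i j ∈ B}

variable {μ : Cardinal.{w}} {ops : Set (I → I → I)}

/-- Closing off under finitely many operations takes `ω` steps. Each step preserves size `< μ`, and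
so does the countable union, because `μ` is regular and uncountable. -/
theorem exists_closedSubsets_superset [Fact μ.IsRegular] [Nonempty I] (hμ : .aleph0 < μ)
    (hops : ops.Finite) (A : Set I) (hA : HasCardinalLT A μ) :
    ∃ B ∈ closedSubsets μ ops, A ⊆ B := by
  let step (A : Set I) : Set I := A ∪ ⋃ x : ops × A × A, {x.1.1 x.2.1 x.2.2}
  have hstep (A : Set I) : A ⊆ step A := Set.subset_union_left
  have hcard (A : Set I) (hA : HasCardinalLT A μ) : HasCardinalLT (step A) μ :=
    have := hops.to_subtype
    hasCardinalLT_union hμ.le hA (hasCardinalLT_iUnion _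
      (hasCardinalLT_prod hμ.le (hasCardinalLT_of_finite _ _ hμ.le)
        (hasCardinalLT_prod hμ.le hA hA)) fun _ => hasCardinalLT_of_finite _ _ hμ.le)
  obtain ⟨i₀⟩ := ‹Nonempty I›
  -- Adding `i₀` ensures nonemptiness.
  let A₀ := A ∪ {i₀}
  have hA₀ : HasCardinalLT A₀ μ := hasCardinalLT_union hμ.le hA (hasCardinalLT_of_finite _ _ hμ.le)
  have hmono : Monotone fun n => step^[n] A₀ := monotone_nat_of_le_succ fun n => by
    rw [Function.iterate_succ_apply']
    exact hstep _
  refine ⟨⋃ n : ℕ, step^[n] A₀, ⟨⟨i₀, Set.mem_iUnion.2 ⟨0, Or.inr rfl⟩⟩, ?_, ?_⟩,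
    fun a ha => Set.mem_iUnion.2 ⟨0, Or.inl ha⟩⟩
  · refine hasCardinalLT_iUnion _ (by simpa [HasCardinalLT] using hμ) fun n => ?_
    induction n with
    | zero => exact hA₀
    | succ n hn =>
      rw [Function.iterate_succ_apply']
      exact hcard _ hn
  · intro o ho i hi j hj
    obtain ⟨m, hm⟩ := Set.mem_iUnion.1 hi
    obtain ⟨n, hn⟩ := Set.mem_iUnion.1 hj
    -- Both arguments are present at stage `max m n`, so the value appears one stage later.
    refine Set.mem_iUnion.2 ⟨max m n + 1, ?_⟩
    rw [Function.iterate_succ_apply']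
    exact Or.inr (Set.mem_iUnion.2 ⟨⟨⟨o, ho⟩, ⟨i, hmono (le_max_left m n) hm⟩,
      ⟨j, hmono (le_max_right m n) hn⟩⟩, rfl⟩)

/-- By regularity a union of fewer than `μ` members still has size `< μ`, so some closed subset
contains it. -/
theorem isCardinalFiltered_closedSubsets [Fact μ.IsRegular] [Nonempty I] (hμ : .aleph0 < μ)
    (hops : ops.Finite) :
    IsCardinalFiltered (closedSubsets μ ops) μ :=
  isCardinalFiltered_preorder _ _ fun K f hK => by
    obtain ⟨B, hB, hAB⟩ := exists_closedSubsets_superset hμ hops (⋃ k, (f k).1)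
      (hasCardinalLT_iUnion _ ((hasCardinalLT_iff_cardinal_mk_lt _ _).2 hK) fun k => (f k).2.2.1)
    exact ⟨⟨B, hB⟩, fun k => (Set.subset_iUnion (fun k => (f k).1) k).trans hAB⟩

theorem isDirectedOrder_of_mem_closedSubsets [PartialOrder I] {u : I → I → I}
    (hu : ∀ i j, i ≤ u i j ∧ j ≤ u i j) (huo : u ∈ ops) {B : Set I}
    (hB : B ∈ closedSubsets μ ops) : IsDirectedOrder B :=
  ⟨fun i j => ⟨⟨u i j, hB.2.2 u huo i i.2 j j.2⟩, hu i j⟩⟩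

theorem hasCardinalLT_arrow_of_preorder {J : Type w} [Preorder J] (hμ : .aleph0 ≤ μ)
    (hJ : HasCardinalLT J μ) : HasCardinalLT (Arrow J) μ :=
  (hasCardinalLT_prod hμ hJ hJ).of_injective (fun f => (f.left, f.right)) fun f g h => by
    obtain ⟨a, b, f⟩ := f
    obtain ⟨a', b', g⟩ := g
    obtain ⟨rfl, rfl⟩ := Prod.mk.inj h
    obtain rfl : f = g := Subsingleton.elim _ _
    rfl

end

/-! ### A directed colimit as a colimit of subcolimits -/

section

variable {C : Type u₁} [Category.{v₁} C] {I : Type w} [PartialOrder I] (D : I ⥤ C)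

/-- The restriction of a diagram to a subset of the indexing poset. -/
abbrev resDiagram (B : Set I) : B ⥤ C := (Subtype.mono_coe (· ∈ B)).functor ⋙ D

variable {D}

variable {𝒢 : Set (Set I)} (cB : ∀ B : 𝒢, ColimitCocone (resDiagram D B.1))

/-- The coprojection of `D i` to the colimit over `B`. -/
def subι (B : 𝒢) {i : I} (hi : i ∈ B.1) : D.obj i ⟶ (cB B).cocone.pt :=
  (cB B).cocone.ι.app ⟨i, hi⟩

theorem subι_w (B : 𝒢) {i j : I} (hi : i ∈ B.1) (hj : j ∈ B.1) (f : i ⟶ j) :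
    D.map f ≫ subι cB B hj = subι cB B hi :=
  (cB B).cocone.w (show (⟨i, hi⟩ : {i // i ∈ B.1}) ⟶ ⟨j, hj⟩ from homOfLE (leOfHom f))

theorem sub_hom_ext {B : 𝒢} {Y : C} {f g : (cB B).cocone.pt ⟶ Y}
    (h : ∀ (i : I) (hi : i ∈ B.1), subι cB B hi ≫ f = subι cB B hi ≫ g) : f = g :=
  (cB B).isColimit.hom_ext fun i => h i.1 i.2

/-- The map from the colimit over `B` given by a compatible family. -/
def subDesc (B : 𝒢) {Y : C} (g : ∀ i ∈ B.1, D.obj i ⟶ Y)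
    (hg : ∀ (i j : I) (hi : i ∈ B.1) (hj : j ∈ B.1) (f : i ⟶ j), D.map f ≫ g j hj = g i hi) :
    (cB B).cocone.pt ⟶ Y :=
  (cB B).isColimit.desc
    { pt := Y
      ι :=
        { app i := g i.1 i.2
          naturality i j f :=
            (hg i.1 j.1 i.2 j.2 ((Subtype.mono_coe (· ∈ B.1)).functor.map f)).trans
              (Category.comp_id _).symm } }

@[simp]
theorem subι_desc (B : 𝒢) {Y : C} (g : ∀ i ∈ B.1, D.obj i ⟶ Y)
    (hg : ∀ (i j : I) (hi : i ∈ B.1) (hj : j ∈ B.1) (f : i ⟶ j), D.map f ≫ g j hj = g i hi)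
    {i : I} (hi : i ∈ B.1) : subι cB B hi ≫ subDesc cB B g hg = g i hi :=
  (cB B).isColimit.fac _ ⟨i, hi⟩

@[simp]
theorem subι_desc_assoc (B : 𝒢) {Y Z : C} (g : ∀ i ∈ B.1, D.obj i ⟶ Y)
    (hg : ∀ (i j : I) (hi : i ∈ B.1) (hj : j ∈ B.1) (f : i ⟶ j), D.map f ≫ g j hj = g i hi)
    {i : I} (hi : i ∈ B.1) (k : Y ⟶ Z) : subι cB B hi ≫ subDesc cB B g hg ≫ k = g i hi ≫ k := by
  rw [← Category.assoc, subι_desc]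

/-- The functor sending a subset in `𝒢` to the colimit over it. -/
abbrev subFunctor : 𝒢 ⥤ C where
  obj B := (cB B).cocone.pt
  map {B B'} h := subDesc cB B (fun _ hi => subι cB B' (leOfHom h hi))
    fun _ _ _ _ f => subι_w cB B' _ _ f
  map_id B := sub_hom_ext cB fun i hi => by simp
  map_comp f g := sub_hom_ext cB fun i hi => by simp

@[simp]
theorem subι_map {B B' : 𝒢} (h : B ⟶ B') {i : I} (hi : i ∈ B.1) :
    subι cB B hi ≫ (subFunctor cB).map h = subι cB B' (leOfHom h hi) :=
  subι_desc cB B (fun _ hi => subι cB B' (leOfHom h hi))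
    (fun _ _ _ _ f => subι_w cB B' _ _ f) hi

theorem subι_map_assoc {B B' : 𝒢} (h : B ⟶ B') {i : I} (hi : i ∈ B.1) {Z : C}
    (k : (cB B').cocone.pt ⟶ Z) :
    subι cB B hi ≫ (subFunctor cB).map h ≫ k = subι cB B' (leOfHom h hi) ≫ k := by
  rw [← subι_map cB h hi, Category.assoc]

/-- The canonical cocone over the functor of subcolimits. -/
abbrev subCocone (c : Cocone D) : Cocone (subFunctor cB) where
  pt := c.pt
  ι :=
    { app B := subDesc cB B (fun i _ => c.ι.app i) fun _ _ _ _ f => c.w f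
      naturality B B' h := sub_hom_ext cB fun i hi => by
        rw [subι_map_assoc cB h]
        simp }

@[simp]
theorem subι_subCocone (c : Cocone D) {B : 𝒢} {i : I} (hi : i ∈ B.1) :
    subι cB B hi ≫ (subCocone cB c).ι.app B = c.ι.app i :=
  subι_desc cB B (fun i _ => c.ι.app i) (fun _ _ _ _ f => c.w f) hi

theorem subι_subCocone_assoc (c : Cocone D) {B : 𝒢} {i : I} (hi : i ∈ B.1) {Z : C}
    (k : c.pt ⟶ Z) :
    subι cB B hi ≫ (subCocone cB c).ι.app B ≫ k = c.ι.app i ≫ k :=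
  (Category.assoc _ _ _).symm.trans (congr_arg (· ≫ k) (subι_subCocone cB c hi))

/-- Two members of the directed family lie in a third, so the leg at `i` does not depend on the
member chosen to contain `i`. -/
theorem subι_comp_ι_eq [IsDirectedOrder 𝒢] (s : Cocone (subFunctor cB)) {B B' : 𝒢} {i : I}
    (hi : i ∈ B.1) (hi' : i ∈ B'.1) :
    subι cB B hi ≫ s.ι.app B = subι cB B' hi' ≫ s.ι.app B' := by
  obtain ⟨B'', h, h'⟩ := exists_ge_ge B B'
  rw [← s.w (homOfLE h), ← s.w (homOfLE h'), subι_map_assoc cB (homOfLE h),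
    subι_map_assoc cB (homOfLE h')]

/-- If `𝒢` is a directed cover, then the colimit is the colimit of the subcolimits. -/
noncomputable def isColimitSubCocone [IsDirectedOrder 𝒢] {c : Cocone D} (hc : IsColimit c)
    (hcov : ∀ i : I, ∃ B : 𝒢, i ∈ B.1) (hcov₂ : ∀ i j : I, ∃ B : 𝒢, i ∈ B.1 ∧ j ∈ B.1) :
    IsColimit (subCocone cB c) :=
  -- The chosen legs form a cocone over `D`: both are compared in a member containing `i` and `j`.
  have hw (s : Cocone (subFunctor cB)) (i j : I) (f : i ⟶ j) :
      D.map f ≫ subι cB (hcov j).choose (hcov j).choose_spec ≫ s.ι.app _ =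
        subι cB (hcov i).choose (hcov i).choose_spec ≫ s.ι.app _ := by
    obtain ⟨B, hi, hj⟩ := hcov₂ i j
    rw [subι_comp_ι_eq cB s (hcov j).choose_spec hj, subι_comp_ι_eq cB s (hcov i).choose_spec hi,
      ← Category.assoc, subι_w cB B hi hj]
  { desc s := hc.desc
      { pt := s.pt
        ι :=
          { app i := subι cB (hcov i).choose (hcov i).choose_spec ≫ s.ι.app _
            naturality i j f := (hw s i j f).trans (Category.comp_id _).symm } }
    fac s B := sub_hom_ext cB fun i hi => by
      rw [subι_subCocone_assoc, hc.fac]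
      exact subι_comp_ι_eq cB s _ hi
    uniq s m hm := hc.hom_ext fun i => by
      rw [hc.fac]
      exact ((congr_arg _ (hm _)).symm.trans (subι_subCocone_assoc ..)).symm }

end

/-! ### Raising the index of accessibility in the presence of directed colimits -/

section

variable {C : Type u₁} [Category.{v₁} C] {D : Type u₂} [Category.{v₂} D]

/-- The colimits of objects in `P` over directed posets of cardinality `< μ`. -/
def directedColimits (P : ObjectProperty C) (μ : Cardinal.{w}) : ObjectProperty C := fun X =>
  ∃ (J : Type w) (_ : PartialOrder J), IsDirectedOrder J ∧ Nonempty J ∧ HasCardinalLT J μ ∧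
    P.colimitsOfShape J X

theorem directedColimits_monotone {P Q : ObjectProperty C} (h : P ≤ Q) (μ : Cardinal.{w}) :
    directedColimits P μ ≤ directedColimits Q μ :=
  fun _ ⟨J, _, h₁, h₂, h₃, h₄⟩ =>
    ⟨J, _, h₁, h₂, h₃, ObjectProperty.colimitsOfShape_monotone J h _ h₄⟩

/-- The `μ`-presentable objects whose image under `F` is `μ`-presentable. -/
def presentableWithImage (F : C ⥤ D) (μ : Cardinal.{w}) [Fact μ.IsRegular] : ObjectProperty C :=
  isCardinalPresentable C μ ⊓ (isCardinalPresentable D μ).inverseImage F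

/-- A `μ`-small colimit of `μ`-presentable objects is `μ`-presentable; this is applied in `C`, and
in `D` to the image colimit, which `F` preserves. -/
theorem directedColimits_presentableWithImage_le [LocallySmall.{w} C] [LocallySmall.{w} D]
    {F : C ⥤ D} (hF : PreservesDirectedColimits.{w} F) (μ : Cardinal.{w}) [Fact μ.IsRegular] :
    directedColimits (presentableWithImage F μ) μ ≤ presentableWithImage F μ := by
  rintro X ⟨J, _, _, _, hJ, ⟨p⟩⟩
  have hJ' := hasCardinalLT_arrow_of_preorder (Cardinal.IsRegular.aleph0_le Fact.out) hJ
  have := hF J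
  constructor
  · have (j : J) : IsCardinalPresentable (p.diag.obj j) μ := (p.prop_diag_obj j).1
    exact isCardinalPresentable_of_isColimit _ p.isColimit μ hJ'
  · have (j : J) : IsCardinalPresentable ((p.diag ⋙ F).obj j) μ := (p.prop_diag_obj j).2
    exact isCardinalPresentable_of_isColimit _ (isColimitOfPreserves F p.isColimit) μ hJ'

/-- A choice of colimits over the members of a family of directed subsets. -/
noncomputable def subColimits (hC : HasDirectedColimits.{w} C) {I : Type w} [PartialOrder I]
    (K : I ⥤ C) {μ : Cardinal.{w}} {ops : Set (I → I → I)} {u : I → I → I}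
    (hu : ∀ i j, i ≤ u i j ∧ j ≤ u i j) (huo : u ∈ ops) (B : closedSubsets μ ops) :
    ColimitCocone (resDiagram K B.1) :=
  have := isDirectedOrder_of_mem_closedSubsets hu huo B.2
  have := B.2.1.to_subtype
  have := hC B.1
  getColimitCocone _

variable {I : Type w} [PartialOrder I] {K : I ⥤ C} {μ : Cardinal.{w}} {ops : Set (I → I → I)}

theorem directedColimits_subColimits {P : ObjectProperty C} (hK : ∀ i, P (K.obj i))
    {u : I → I → I} (hu : ∀ i j, i ≤ u i j ∧ j ≤ u i j) (huo : u ∈ ops)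
    (cB : ∀ B : closedSubsets μ ops, ColimitCocone (resDiagram K B.1))
    (B : closedSubsets μ ops) : directedColimits P μ (cB B).cocone.pt :=
  ⟨B.1, _, isDirectedOrder_of_mem_closedSubsets hu huo B.2, B.2.1.to_subtype, B.2.2.1,
    ⟨{ diag := _, ι := _, isColimit := (cB B).isColimit, prop_diag_obj i := hK i.1 }⟩⟩

/-- A directed colimit is the colimit of its subcolimits over closed subsets. -/
noncomputable def isColimitClosedSubsets [Fact μ.IsRegular] [Nonempty I] (hμ : .aleph0 < μ)
    (hops : ops.Finite) (cB : ∀ B : closedSubsets μ ops, ColimitCocone (resDiagram K B.1))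
    {c : Cocone K} (hc : IsColimit c) : IsColimit (subCocone cB c) :=
  have := isCardinalFiltered_closedSubsets hμ hops
  have := isFiltered_of_isCardinalFiltered (closedSubsets μ ops) μ
  have : IsDirectedOrder (closedSubsets μ ops) := IsFiltered.isDirectedOrder _
  have hcov (i j : I) : ∃ B : closedSubsets μ ops, i ∈ B.1 ∧ j ∈ B.1 := by
    obtain ⟨B, hB, h⟩ := exists_closedSubsets_superset hμ hops {i, j}
      (hasCardinalLT_of_finite _ _ hμ.le)
    exact ⟨⟨B, hB⟩, h (by simp), h (by simp)⟩
  isColimitSubCocone cB hc (fun i => (hcov i i).imp fun _ h => h.1) hcov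

/-- A choice of upper bounds turns directedness of a subset into closure under a binary operation.
-/
theorem exists_upperBound [IsDirectedOrder I] :
    ∃ u : I → I → I, ∀ i j, i ≤ u i j ∧ j ≤ u i j := by
  choose u hu using fun i j : I => exists_ge_ge i j
  exact ⟨u, hu⟩

theorem exists_directed_colimitOfShape {P : ObjectProperty C} {κ : Cardinal.{w}} [Fact κ.IsRegular]
    (hP : P.IsCardinalFilteredGenerator κ) (X : C) :
    ∃ (I : Type w) (_ : PartialOrder I), IsCardinalFiltered I κ ∧ IsDirectedOrder I ∧ Nonempty I ∧
      P.colimitsOfShape I X := by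
  obtain ⟨J, _, _, hX⟩ := hP.exists_colimitsOfShape X
  obtain ⟨I, _, _, G, _⟩ := IsCardinalFiltered.exists_cardinal_directed J κ
  have := isFiltered_of_isCardinalFiltered I κ
  exact ⟨I, _, inferInstance, IsFiltered.isDirectedOrder _, IsFiltered.nonempty,
    P.colimitsOfShape_le_of_final G _ hX⟩

/-- The subcolimits over directed subsets of size `< μ` are `μ`-presentable and exhibit `X` as a
`μ`-filtered colimit. These subsets need only be directed, not `κ`-directed. Since all directed
colimits exist, `κ ≤ μ` with `μ` uncountable suffices and no sharper relation between the cardinals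
is required. -/
theorem directedColimits_isCardinalFilteredGenerator [LocallySmall.{w} C]
    (hC : HasDirectedColimits.{w} C) {P : ObjectProperty C} {κ : Cardinal.{w}} [Fact κ.IsRegular]
    (hP : P.IsCardinalFilteredGenerator κ) [Fact μ.IsRegular] (hκ : κ ≤ μ) (hμ : .aleph0 < μ) :
    (directedColimits P μ).IsCardinalFilteredGenerator μ where
  le_isCardinalPresentable := by
    rintro X ⟨J, _, _, _, hJ, ⟨p⟩⟩
    exact p.isCardinalPresentable hP.le_isCardinalPresentable μ hκ
      (hasCardinalLT_arrow_of_preorder hμ.le hJ)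
  exists_colimitsOfShape X := by
    obtain ⟨I, _, _, _, _, ⟨p⟩⟩ := exists_directed_colimitOfShape hP X
    obtain ⟨u, hu⟩ := exists_upperBound (I := I)
    have huo : u ∈ ({u} : Set (I → I → I)) := rfl
    let cB := subColimits hC p.diag (μ := μ) hu huo
    exact ⟨closedSubsets μ {u}, inferInstance,
      isCardinalFiltered_closedSubsets hμ (Set.finite_singleton u),
      ⟨{  diag := _
          ι := _
          isColimit := isColimitClosedSubsets hμ (Set.finite_singleton u) cB p.isColimit
          prop_diag_obj := directedColimits_subColimits p.prop_diag_obj hu huo cB }⟩⟩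

/-- Each object is presentable for some cardinal, and a small family of cardinals has a supremum. -/
theorem exists_le_regular_presentable {ι : Type*} [Small.{w} ι] [IsAccessibleCategory.{w} D]
    (X : ι → D) : ∃ μ₀ : Cardinal.{w}, ∀ (μ : Cardinal.{w}) [Fact μ.IsRegular], μ₀ ≤ μ →
      ∀ i, IsCardinalPresentable (X i) μ := by
  have hX (i : ι) : IsPresentable.{w} (X i) := inferInstance
  choose κ hκ h using fun i => (hX i).exists_cardinal
  refine ⟨⨆ i, κ i, fun μ _ hμ i => ?_⟩
  have := h i
  exact isCardinalPresentable_of_le _ ((le_ciSup (Cardinal.bddAbove_of_small) i).trans hμ)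

/-- In an accessible category with directed colimits, for all large enough regular `μ`, the
`μ`-presentable objects with `μ`-presentable image under `F` form a `μ`-filtered generator. -/
theorem exists_presentableWithImage_generator [IsAccessibleCategory.{w} C]
    [IsAccessibleCategory.{w} D] (hC : HasDirectedColimits.{w} C) {F : C ⥤ D}
    (hF : PreservesDirectedColimits.{w} F) :
    ∃ μ₀ : Cardinal.{w}, ∀ (μ : Cardinal.{w}) [Fact μ.IsRegular], μ₀ ≤ μ → .aleph0 < μ ∧
      HasCardinalFilteredGenerator C μ ∧
      (presentableWithImage F μ).IsCardinalFilteredGenerator μ := by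
  obtain ⟨κ, _, _⟩ := IsAccessibleCategory.exists_cardinal C
  obtain ⟨κ', _, _⟩ := IsAccessibleCategory.exists_cardinal D
  obtain ⟨P, _, hP⟩ := HasCardinalFilteredGenerator.exists_small_generator C κ
  obtain ⟨μ₁, hμ₁⟩ := exists_le_regular_presentable fun a : Subtype P => F.obj a.1
  -- `κ` permits raising the index, `μ₁` makes the images of the generators in `P` `μ`-presentable,
  -- and the successor of `ℵ₀` makes `μ` uncountable.
  refine ⟨κ ⊔ μ₁ ⊔ Order.succ .aleph0, fun μ _ hμ => ?_⟩
  simp only [sup_le_iff, Order.succ_le_iff] at hμ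
  obtain ⟨⟨hκ, hμ₁'⟩, hμ⟩ := hμ
  have hgen := directedColimits_isCardinalFilteredGenerator hC hP hκ hμ
  have hle : P ≤ presentableWithImage F μ := fun X hX =>
    ⟨isCardinalPresentable_monotone C hκ _ (hP.le_isCardinalPresentable _ hX),
      hμ₁ μ hμ₁' ⟨X, hX⟩⟩
  -- Essential smallness is inherited from the closure of the small `P` under `μ`-small colimits.
  have hle' : directedColimits P μ ≤ P.colimitsCardinalClosure μ := by
    rintro X ⟨J, _, _, _, hJ, ⟨p⟩⟩
    have := P.isClosedUnderColimitsOfShape_colimitsCardinalClosure μ J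
      (hasCardinalLT_arrow_of_preorder hμ.le hJ)
    exact (p.ofLE (P.le_colimitsCardinalClosure μ)).prop
  have : ObjectProperty.EssentiallySmall.{w} (directedColimits P μ) := .of_le hle'
  refine ⟨hμ, hgen.hasCardinalFilteredGenerator, hgen.of_le_isoClosure ?_ inf_le_left⟩
  exact ((directedColimits_monotone hle μ).trans
    (directedColimits_presentableWithImage_le hF μ)).trans (ObjectProperty.le_isoClosure _)

theorem exists_regular_ge (μ₀ : Cardinal.{w}) : ∃ μ : Cardinal.{w}, μ.IsRegular ∧ μ₀ ≤ μ :=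
  ⟨Order.succ (μ₀ ⊔ .aleph0), Cardinal.isRegular_succ le_sup_right,
    le_sup_left.trans (Order.le_succ _)⟩

end

/-- Preservation of a filtered colimit by `Hom(X, -)` amounts to existence and essential uniqueness
of factorisations through a stage. -/
theorem isCardinalPresentable_of_exists {C : Type u₁} [Category.{v₁} C] {X : C} {μ : Cardinal.{w}}
    [Fact μ.IsRegular]
    (h₁ : ∀ (J : Type w) [SmallCategory J] [IsCardinalFiltered J μ] (F : J ⥤ C) (c : Cocone F)
      (_ : IsColimit c) (f : X ⟶ c.pt), ∃ (j : J) (g : X ⟶ F.obj j), g ≫ c.ι.app j = f)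
    (h₂ : ∀ (J : Type w) [SmallCategory J] [IsCardinalFiltered J μ] (F : J ⥤ C) (c : Cocone F)
      (_ : IsColimit c) (i : J) (f g : X ⟶ F.obj i), f ≫ c.ι.app i = g ≫ c.ι.app i →
        ∃ (j : J) (a : i ⟶ j), f ≫ F.map a = g ≫ F.map a) :
    IsCardinalPresentable X μ where
  preservesColimitOfShape J _ _ := ⟨fun {F} => ⟨fun {c} hc => ⟨by
    have := isFiltered_of_isCardinalFiltered J μ
    refine Types.FilteredColimit.isColimitOf' _ _ (fun f => ?_) (fun i f g h => ?_)
    · obtain ⟨j, g, hg⟩ := h₁ J F c hc f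
      exact ⟨j, g, hg.symm⟩
    · exact h₂ J F c hc i f g h⟩⟩⟩

/-! ### Products of accessible categories with directed colimits -/

namespace PiCat

variable {I : Type w} {K : I → Type u₁} [∀ i, Category.{v₁} (K i)]

section

variable {J : Type*} [Category* J]

/-- A cocone in a product category is a colimit if its components are. -/
def isColimitOfEval {F : J ⥤ ∀ i, K i} {c : Cocone F}
    (hc : ∀ i, IsColimit ((Pi.eval K i).mapCocone c)) : IsColimit c where
  desc s i := (hc i).desc ((Pi.eval K i).mapCocone s)
  fac s j := funext fun i => (hc i).fac ((Pi.eval K i).mapCocone s) j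
  uniq s m hm := funext fun i => (hc i).uniq ((Pi.eval K i).mapCocone s) (m i)
    fun j => congr_fun (hm j) i

/-- The cocone in a product category given by cocones on the components. -/
abbrev piCocone (F : J ⥤ ∀ i, K i) (c : ∀ i, Cocone (F ⋙ Pi.eval K i)) : Cocone F where
  pt i := (c i).pt
  ι :=
    { app j i := (c i).ι.app j
      naturality _ _ f := funext fun i => (c i).ι.naturality f }

/-- A componentwise colimit cocone in a product category is a colimit. -/
def isColimitPiCocone {F : J ⥤ ∀ i, K i} {c : ∀ i, Cocone (F ⋙ Pi.eval K i)}
    (hc : ∀ i, IsColimit (c i)) : IsColimit (piCocone F c) :=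
  isColimitOfEval fun i => IsColimit.ofIsoColimit (hc i)
    (Cocone.ext (Iso.refl _) fun _ => Category.comp_id _)

theorem hasColimitsOfShape [∀ i, HasColimitsOfShape J (K i)] :
    HasColimitsOfShape J (∀ i, K i) where
  has_colimit _ := ⟨⟨_, isColimitPiCocone fun _ => colimit.isColimit _⟩⟩

theorem preservesColimitsOfShape_eval [∀ i, HasColimitsOfShape J (K i)] (i : I) :
    PreservesColimitsOfShape J (Pi.eval K i) where
  preservesColimit {F} := preservesColimit_of_preserves_colimit_cocone
    (isColimitPiCocone fun i => colimit.isColimit (F ⋙ Pi.eval K i))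
    (IsColimit.ofIsoColimit (colimit.isColimit (F ⋙ Pi.eval K i))
      (Cocone.ext (Iso.refl _) fun _ => Category.comp_id _))

theorem preservesColimitsOfShape_of_eval {T : Type*} [Category* T] {h : T ⥤ ∀ i, K i}
    (hh : ∀ i, PreservesColimitsOfShape J (h ⋙ Pi.eval K i)) : PreservesColimitsOfShape J h where
  preservesColimit := ⟨fun hc => ⟨isColimitOfEval fun i =>
    IsColimit.ofIsoColimit (isColimitOfPreserves (h ⋙ Pi.eval K i) hc)
      (Cocone.ext (Iso.refl _) fun _ => Category.comp_id _)⟩⟩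

end

theorem hasDirectedColimits (hK : ∀ i, HasDirectedColimits.{w} (K i)) :
    HasDirectedColimits.{w} (∀ i, K i) := fun J _ _ _ =>
  have := fun i => hK i J
  hasColimitsOfShape

theorem preservesDirectedColimits_eval (hK : ∀ i, HasDirectedColimits.{w} (K i)) (i : I) :
    PreservesDirectedColimits.{w} (Pi.eval K i) := fun J _ _ _ =>
  have := fun i => hK i J
  preservesColimitsOfShape_eval i

/-- Each component factors, or becomes equal, at its own stage; as `I` has size `< μ`, these stages
have a common successor in a `μ`-filtered category. -/
theorem isCardinalPresentable_pi (hK : ∀ i, HasDirectedColimits.{w} (K i)) {μ : Cardinal.{w}}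
    [Fact μ.IsRegular] (hI : HasCardinalLT I μ) {X : ∀ i, K i}
    (hX : ∀ i, IsCardinalPresentable (X i) μ) : IsCardinalPresentable X μ := by
  have hev (i : I) := (preservesDirectedColimits_eval hK i).isCardinalAccessible μ
  refine isCardinalPresentable_of_exists (fun J _ _ F c hc f => ?_) fun J _ _ F c hc j f g h => ?_
  · have := fun i => (Pi.eval K i).preservesColimitsOfShape_of_isCardinalAccessible μ J
    choose j g hg using fun i => IsCardinalPresentable.exists_hom_of_isColimit μ
      (isColimitOfPreserves (Pi.eval K i) hc) (f i)
    refine ⟨IsCardinalFiltered.max j hI,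
      fun i => g i ≫ F.map (IsCardinalFiltered.toMax j hI i) i, funext fun i => ?_⟩
    have := congr_fun (c.w (IsCardinalFiltered.toMax j hI i)) i
    rw [← hg i]
    exact (Category.assoc _ _ _).trans (congr_arg (g i ≫ ·) this)
  · have := fun i => (Pi.eval K i).preservesColimitsOfShape_of_isCardinalAccessible μ J
    choose k a ha using fun i => IsCardinalPresentable.exists_eq_of_isColimit' μ
      (isColimitOfPreserves (Pi.eval K i) hc) (f i) (g i) (congr_fun h i)
    -- All the `a i` start at `j`; they are merged into a single `d : j ⟶ m` with `a i ≫ b i = d`.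
    obtain ⟨m, b, d, hm⟩ := IsCardinalFiltered.wideSpan a hI
    refine ⟨m, d, funext fun i => ?_⟩
    have := ha i
    rw [← hm i, F.map_comp]
    exact (Category.assoc _ _ _).symm.trans ((congr_arg (· ≫ F.map (b i) i) this).trans
      (Category.assoc _ _ _))

theorem hasCardinalFilteredGenerator (hK : ∀ i, HasDirectedColimits.{w} (K i)) {μ : Cardinal.{w}}
    [Fact μ.IsRegular] (hI : HasCardinalLT I μ) [∀ i, HasCardinalFilteredGenerator (K i) μ] :
    HasCardinalFilteredGenerator (∀ i, K i) μ := by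
  choose P _ hP using fun i => HasCardinalFilteredGenerator.exists_small_generator (K i) μ
  let Q : ObjectProperty (∀ i, K i) := .ofObj fun (a : ∀ i, Subtype (P i)) i => (a i).1
  have hQ : Q.IsCardinalFilteredGenerator μ :=
    { le_isCardinalPresentable := by
        rintro _ ⟨a⟩
        exact isCardinalPresentable_pi hK hI fun i => (hP i).le_isCardinalPresentable _ (a i).2
      exists_colimitsOfShape X := by
        choose J _ _ p using fun i => (hP i).exists_colimitsOfShape (X i)
        have := fun i => isFiltered_of_isCardinalFiltered (J i) μ
        let p' (i : I) := (p i).some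
        have (i : I) : (Pi.eval J i).Final := final_eval i
        -- The product of the index categories is again `μ`-filtered, and its evaluations are final,
        -- so each component of the cocone remains a colimit.
        refine ⟨∀ i, J i, inferInstance, inferInstance,
          ⟨{  diag := Functor.pi fun i => (p' i).diag
              ι := { app := fun j i => (p' i).ι.app (j i)
                     naturality := fun j k f => funext fun i => (p' i).ι.naturality (f i) }
              isColimit := isColimitOfEval fun i => ?_
              prop_diag_obj := fun j => ?_ }⟩⟩
        · exact IsColimit.ofIsoColimit ((Functor.Final.isColimitWhiskerEquiv (Pi.eval J i) _).symm
            (p' i).isColimit) (Cocone.ext (Iso.refl _) fun _ => Category.comp_id _)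
        · exact ObjectProperty.ofObj_apply
            (fun (a : ∀ i, Subtype (P i)) i => (a i).1) fun i => ⟨_, (p' i).prop_diag_obj (j i)⟩ }
  have : LocallySmall.{w} (∀ i, K i) :=
    ⟨fun X Y => inferInstanceAs (Small.{w} (∀ i, X i ⟶ Y i))⟩
  exact hQ.hasCardinalFilteredGenerator

theorem isAccessibleCategory (hK : ∀ i, HasDirectedColimits.{w} (K i))
    [∀ i, IsAccessibleCategory.{w} (K i)] : IsAccessibleCategory.{w} (∀ i, K i) := by
  -- With the identity functor the condition on images adds nothing; only accessibility of `K i` at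
  -- all large `μ` is used.
  choose μ₀ hμ₀ using fun i => exists_presentableWithImage_generator (hK i)
    (F := 𝟭 (K i)) fun _ _ _ _ => inferInstance
  obtain ⟨μ, hμ, hle⟩ := exists_regular_ge ((⨆ i, μ₀ i) ⊔ Order.succ (Cardinal.mk I))
  simp only [sup_le_iff, Order.succ_le_iff] at hle
  have : Fact μ.IsRegular := ⟨hμ⟩
  have (i : I) : HasCardinalFilteredGenerator (K i) μ :=
    (hμ₀ i μ ((le_ciSup Cardinal.bddAbove_of_small i).trans hle.1)).2.1
  have := hasCardinalFilteredGenerator hK ((hasCardinalLT_iff_cardinal_mk_lt _ _).2 hle.2)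
  have := (hasDirectedColimits hK).hasCardinalFilteredColimits μ
  exact ⟨μ, inferInstance, { }⟩

theorem isAccessible_of_eval {T : Type*} [Category* T] {h : T ⥤ ∀ i, K i}
    (hh : ∀ i, (h ⋙ Pi.eval K i).IsAccessible.{w}) : h.IsAccessible.{w} := by
  choose κ hκ hacc using fun i => (hh i).exists_cardinal
  obtain ⟨μ, hμ, hle⟩ := exists_regular_ge (⨆ i, κ i)
  have : Fact μ.IsRegular := ⟨hμ⟩
  refine ⟨μ, inferInstance, ⟨fun J _ _ => preservesColimitsOfShape_of_eval fun i => ?_⟩⟩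
  have := hacc i
  have := (h ⋙ Pi.eval K i).isCardinalAccessible_of_le
    ((le_ciSup Cardinal.bddAbove_of_small i).trans hle)
  exact (h ⋙ Pi.eval K i).preservesColimitsOfShape_of_isCardinalAccessible μ J

end PiCat

/-! ### Inserters of accessible categories with directed colimits -/

namespace Ins

variable {C : Type u₁} [Category.{v₁} C] {D : Type u₂} [Category.{v₂} D] {F G : C ⥤ D}

theorem hom_w {A B : Ins F G} (f : A ⟶ B) :
    A.str ≫ G.map (Hom.base f) = F.map (Hom.base f) ≫ B.str :=
  Hom.w f

theorem hom_w_assoc {A B : Ins F G} (f : A ⟶ B) {Z : D} (k : G.obj B.base ⟶ Z) :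
    A.str ≫ G.map (Hom.base f) ≫ k = F.map (Hom.base f) ≫ B.str ≫ k := by
  rw [← Category.assoc, hom_w, Category.assoc]

theorem hom_ext' {A B : Ins F G} {f g : A ⟶ B} (h : (proj F G).map f = (proj F G).map g) : f = g :=
  Hom.ext h

/-- Constructor for morphisms of the inserter category. -/
def homMk {A B : Ins F G} (f : A.base ⟶ B.base) (hf : A.str ≫ G.map f = F.map f ≫ B.str) : A ⟶ B :=
  ⟨f, hf⟩

instance : (proj F G).Faithful where
  map_injective := hom_ext'

/-- Constructor for isomorphisms of the inserter category. -/
def isoMk {A B : Ins F G} (e : A.base ≅ B.base) (he : A.str ≫ G.map e.hom = F.map e.hom ≫ B.str) :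
    A ≅ B where
  hom := homMk e.hom he
  inv := homMk e.inv (by
    rw [← cancel_epi (F.map e.hom), ← reassoc_of% he, ← Functor.map_comp, ← Functor.map_comp_assoc]
    simp)
  hom_inv_id := hom_ext' e.hom_inv_id
  inv_hom_id := hom_ext' e.inv_hom_id

/-- When the morphisms `F.map (Hom.base i)` are jointly epic, this makes `d` a morphism of inserter
objects. -/
theorem comp_str_comp_map {A B S : Ins F G} (i : A ⟶ B) (s : A ⟶ S) (d : B.base ⟶ S.base)
    (h : Hom.base i ≫ d = Hom.base s) :
    F.map (Hom.base i) ≫ B.str ≫ G.map d = F.map (Hom.base i) ≫ F.map d ≫ S.str := by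
  rw [← hom_w_assoc, ← G.map_comp, h, hom_w, ← F.map_comp_assoc, h]

theorem map_comp_str_comp_map {A B : Ins F G} {Z : C} (f : A ⟶ B) {a : A.base ⟶ Z}
    {b : B.base ⟶ Z} (h : Hom.base f ≫ b = a) :
    F.map (Hom.base f) ≫ B.str ≫ G.map b = A.str ≫ G.map a := by
  rw [← hom_w_assoc, ← G.map_comp, h]

/-- A factorisation `g` on bases may fail to respect the structure morphisms, but the discrepancy
vanishes in `G.obj S.base`. Presentability makes it vanish at some stage, where `str_comp_map_comp`
applies. -/
theorem str_comp_eq_of_comp_eq {A B S : Ins F G} (f : A ⟶ S) (i : B ⟶ S) (g : A.base ⟶ B.base)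
    (h : g ≫ Hom.base i = Hom.base f) :
    (A.str ≫ G.map g) ≫ G.map (Hom.base i) = (F.map g ≫ B.str) ≫ G.map (Hom.base i) := by
  rw [Category.assoc, Category.assoc, ← G.map_comp, h, hom_w, hom_w, ← F.map_comp_assoc, h]

theorem str_comp_map_comp {A B S : Ins F G} {g : A.base ⟶ B.base} (a : B ⟶ S)
    (h : (A.str ≫ G.map g) ≫ G.map (Hom.base a) = (F.map g ≫ B.str) ≫ G.map (Hom.base a)) :
    A.str ≫ G.map (g ≫ Hom.base a) = F.map (g ≫ Hom.base a) ≫ S.str := by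
  rw [G.map_comp, F.map_comp_assoc, ← hom_w, ← Category.assoc, h, Category.assoc]

section

variable {J : Type*} [Category* J] {K : J ⥤ Ins F G}

/-- The projection of the inserter category reflects the colimits preserved by `F`. -/
noncomputable def isColimitOfProj {c : Cocone K} (hc : IsColimit ((proj F G).mapCocone c))
    [PreservesColimit (K ⋙ proj F G) F] : IsColimit c where
  desc s := homMk (hc.desc ((proj F G).mapCocone s))
    ((isColimitOfPreserves F hc).hom_ext fun j =>
      comp_str_comp_map (c.ι.app j) (s.ι.app j) _ (hc.fac ((proj F G).mapCocone s) j))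
  fac s j := hom_ext' (hc.fac ((proj F G).mapCocone s) j)
  uniq s m hm := hom_ext' (hc.uniq ((proj F G).mapCocone s) ((proj F G).map m) fun j =>
    congr_arg (proj F G).map (hm j))

/-- The cocone given by the structure morphisms of a diagram and a cocone over its projection. -/
abbrev strCocone (c : Cocone (K ⋙ proj F G)) : Cocone ((K ⋙ proj F G) ⋙ F) where
  pt := G.obj c.pt
  ι :=
    { app j := (K.obj j).str ≫ G.map (c.ι.app j)
      naturality _ _ f := (map_comp_str_comp_map (K.map f) (c.w f)).trans
        (Category.comp_id _).symm }

/-- The lift to the inserter category of a colimit cocone preserved by `F`. -/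
abbrev liftCocone (c : Cocone (K ⋙ proj F G)) (hc : IsColimit (F.mapCocone c)) :
    Cocone K where
  pt := ⟨c.pt, hc.desc (strCocone c)⟩
  ι :=
    { app j := homMk (B := ⟨c.pt, hc.desc (strCocone c)⟩) (c.ι.app j)
        (hc.fac (strCocone c) j).symm
      naturality _ _ f := hom_ext' (c.ι.naturality f) }

/-- The image of the lifted cocone is the original one. -/
def projLiftCocone (c : Cocone (K ⋙ proj F G)) (hc : IsColimit (F.mapCocone c)) :
    (proj F G).mapCocone (liftCocone c hc) ≅ c :=
  Cocone.ext (show ((proj F G).mapCocone (liftCocone c hc)).pt ≅ c.pt from Iso.refl c.pt)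
    fun j => Category.comp_id (c.ι.app j)

variable (F G) in
-- The structure morphism of the colimit starts at the value of `F`, so only `F` has to preserve
-- colimits.
theorem hasColimitsOfShape (J : Type*) [Category* J] [HasColimitsOfShape J C]
    [PreservesColimitsOfShape J F] : HasColimitsOfShape J (Ins F G) where
  has_colimit K := ⟨⟨liftCocone (colimit.cocone (K ⋙ proj F G))
    (isColimitOfPreserves F (colimit.isColimit _)),
    isColimitOfProj (IsColimit.ofIsoColimit (colimit.isColimit _) (projLiftCocone _ _).symm)⟩⟩

variable (F G) in
theorem preservesColimitsOfShape_proj (J : Type*) [Category* J] [HasColimitsOfShape J C]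
    [PreservesColimitsOfShape J F] : PreservesColimitsOfShape J (proj F G) where
  preservesColimit {K} :=
    have h := IsColimit.ofIsoColimit (colimit.isColimit (K ⋙ proj F G))
      (projLiftCocone _ (isColimitOfPreserves F (colimit.isColimit _))).symm
    preservesColimit_of_preserves_colimit_cocone (isColimitOfProj h) h

theorem preservesColimitsOfShape_of_proj {T : Type*} [Category* T] {h : T ⥤ Ins F G}
    [PreservesColimitsOfShape J F] (hh : PreservesColimitsOfShape J (h ⋙ proj F G)) :
    PreservesColimitsOfShape J h where
  preservesColimit {K} := ⟨fun hc => ⟨by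
    have : PreservesColimit ((K ⋙ h) ⋙ proj F G) F := inferInstance
    exact isColimitOfProj (IsColimit.ofIsoColimit (isColimitOfPreserves (h ⋙ proj F G) hc)
      (Cocone.ext (Iso.refl _) fun _ => Category.comp_id _))⟩⟩

end

theorem hasDirectedColimits (hC : HasDirectedColimits.{w} C)
    (hF : PreservesDirectedColimits.{w} F) : HasDirectedColimits.{w} (Ins F G) := fun J _ _ _ =>
  have := hC J
  have := hF J
  hasColimitsOfShape F G J

variable (G) in
theorem preservesDirectedColimits_proj (hC : HasDirectedColimits.{w} C)
    (hF : PreservesDirectedColimits.{w} F) : PreservesDirectedColimits.{w} (proj F G) :=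
  fun J _ _ _ =>
  have := hC J
  have := hF J
  preservesColimitsOfShape_proj F G J

/-- Presentability of `A.base` factors the underlying morphism through a stage; presentability of
`F.obj A.base` makes the structure square commute at a later one, because `proj F G` and `G`
preserve the colimit. -/
theorem isCardinalPresentable (hC : HasDirectedColimits.{w} C)
    (hF : PreservesDirectedColimits.{w} F) (hG : PreservesDirectedColimits.{w} G)
    {μ : Cardinal.{w}} [Fact μ.IsRegular] {A : Ins F G}
    (hA : presentableWithImage F μ A.base) : IsCardinalPresentable A μ := by
  have : IsCardinalPresentable A.base μ := hA.1
  have : IsCardinalPresentable (F.obj A.base) μ := hA.2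
  have := (preservesDirectedColimits_proj G hC hF).isCardinalAccessible μ
  have := hG.isCardinalAccessible μ
  refine isCardinalPresentable_of_exists (fun J _ _ K c hc f => ?_) fun J _ _ K c hc j f g h => ?_
  · have := (proj F G).preservesColimitsOfShape_of_isCardinalAccessible μ J
    have := G.preservesColimitsOfShape_of_isCardinalAccessible μ J
    have hc' := isColimitOfPreserves (proj F G) hc
    obtain ⟨i, g, hg⟩ := IsCardinalPresentable.exists_hom_of_isColimit μ hc'
      (X := A.base) ((proj F G).map f)
    obtain ⟨j, a, ha⟩ := IsCardinalPresentable.exists_eq_of_isColimit' μ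
      (isColimitOfPreserves G hc') (A.str ≫ G.map g) (F.map g ≫ (K.obj i).str)
      (str_comp_eq_of_comp_eq f (c.ι.app i) g hg)
    refine ⟨j, homMk (g ≫ Hom.base (K.map a)) (str_comp_map_comp (K.map a) ha), hom_ext' ?_⟩
    rw [← hg]
    refine (Category.assoc _ _ _).trans (congr_arg (g ≫ ·) ?_)
    exact congr_arg (proj F G).map (c.w a)
  · have := (proj F G).preservesColimitsOfShape_of_isCardinalAccessible μ J
    obtain ⟨k, a, ha⟩ := IsCardinalPresentable.exists_eq_of_isColimit' μ
      (isColimitOfPreserves (proj F G) hc) (X := A.base) ((proj F G).map f) ((proj F G).map g)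
      (congr_arg (proj F G).map h)
    exact ⟨k, a, hom_ext' ha⟩

/-- Local smallness of `D` leaves only a small set of structure morphisms on each base, and
isomorphisms of bases transport them by conjugation. -/
theorem essentiallySmall_inverseImage_proj [LocallySmall.{w} D] (P : ObjectProperty C)
    [ObjectProperty.EssentiallySmall.{w} P] :
    ObjectProperty.EssentiallySmall.{w} (P.inverseImage (proj F G)) := by
  obtain ⟨Q, _, -, hQ⟩ := ObjectProperty.EssentiallySmall.exists_small_le P
  let X (x : Σ a : Subtype Q, F.obj a.1 ⟶ G.obj a.1) : Ins F G := ⟨x.1.1, x.2⟩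
  refine ⟨.ofObj X, inferInstance, fun A hA => ?_⟩
  obtain ⟨a, ha, ⟨e⟩⟩ := hQ _ hA
  change A.base ≅ a at e
  refine ⟨_, ObjectProperty.ofObj_apply X ⟨⟨a, ha⟩, F.map e.inv ≫ A.str ≫ G.map e.hom⟩,
    ⟨isoMk (B := ⟨a, F.map e.inv ≫ A.str ≫ G.map e.hom⟩) e ?_⟩⟩
  change A.str ≫ G.map e.hom = F.map e.hom ≫ F.map e.inv ≫ A.str ≫ G.map e.hom
  rw [← F.map_comp_assoc, e.hom_inv_id, F.map_id, Category.id_comp]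

end Ins

theorem locallySmall_of_isAccessibleCategory (C : Type u₁) [Category.{v₁} C]
    [IsAccessibleCategory.{w} C] : LocallySmall.{w} C := by
  obtain ⟨κ, _, _⟩ := IsAccessibleCategory.exists_cardinal.{w} C
  have : HasCardinalFilteredGenerator C κ := inferInstance
  infer_instance

namespace Ins

variable {C : Type u₁} [Category.{v₁} C] {D : Type u₂} [Category.{v₂} D] {F G : C ⥤ D}

/-! ### Inserters of accessible categories are accessible -/

section

variable {I : Type w} [PartialOrder I] {K : I ⥤ C}

/-- A morphism `f` between images of a `μ`-filtered colimit of objects with `μ`-presentable image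
under `F` is described by morphisms `g i` between images of the objects of the diagram. -/
theorem exists_components {μ : Cardinal.{w}} [Fact μ.IsRegular] [IsCardinalFiltered I μ]
    {c : Cocone K} (hc : IsColimit c) [PreservesColimitsOfShape I G]
    (hK : ∀ i, IsCardinalPresentable (F.obj (K.obj i)) μ) (f : F.obj c.pt ⟶ G.obj c.pt) :
    ∃ (s : I → I) (g : ∀ i, F.obj (K.obj i) ⟶ G.obj (K.obj (s i))) (t : I → I → I),
      (∀ i, g i ≫ G.map (c.ι.app (s i)) = F.map (c.ι.app i) ≫ f) ∧
      ∀ i j (h : i ⟶ j), ∃ (a : s i ⟶ t i j) (b : s j ⟶ t i j),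
        g i ≫ G.map (K.map a) = F.map (K.map h) ≫ g j ≫ G.map (K.map b) := by
  have hGc := isColimitOfPreserves G hc
  choose s g hg using fun i => IsCardinalPresentable.exists_hom_of_isColimit μ hGc
    (X := F.obj (K.obj i)) (F.map (c.ι.app i) ≫ f)
  replace hg (i : I) : g i ≫ G.map (c.ι.app (s i)) = F.map (c.ι.app i) ≫ f := hg i
  have ht (i j : I) : ∃ k, ∀ h : i ⟶ j, ∃ (a : s i ⟶ k) (b : s j ⟶ k),
      g i ≫ G.map (K.map a) = F.map (K.map h) ≫ g j ≫ G.map (K.map b) := by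
    by_cases hij : i ≤ j
    · obtain ⟨k, a, b, hk⟩ := IsCardinalPresentable.exists_eq_of_isColimit μ hGc
        (g i) (F.map (K.map (homOfLE hij)) ≫ g j) (by
          change g i ≫ G.map (c.ι.app (s i)) = (_ ≫ g j) ≫ G.map (c.ι.app (s j))
          rw [Category.assoc, hg, hg, ← F.map_comp_assoc, c.w])
      exact ⟨k, fun _ => ⟨a, b, hk.trans (Category.assoc _ _ _)⟩⟩
    -- A default value: there is no `i ⟶ j`, but `t` must be total to serve as a closure operation.
    · exact ⟨i, fun h => (hij (leOfHom h)).elim⟩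
  choose t ht using ht
  exact ⟨s, g, t, hg, ht⟩

variable {𝒢 : Set (Set I)} {cB : ∀ B : 𝒢, ColimitCocone (resDiagram K B.1)}

/-- The components agree at stage `t i j`; since this stage belongs to `B`, they agree in the
colimit over `B`. -/
theorem map_comp_components {s : I → I} {t : I → I → I}
    {g : ∀ i, F.obj (K.obj i) ⟶ G.obj (K.obj (s i))}
    (hg : ∀ i j (h : i ⟶ j), ∃ (a : s i ⟶ t i j) (b : s j ⟶ t i j),
        g i ≫ G.map (K.map a) = F.map (K.map h) ≫ g j ≫ G.map (K.map b))
    (B : 𝒢) {i j : I} (hi : s i ∈ B.1) (hj : s j ∈ B.1) (hk : t i j ∈ B.1) (h : i ⟶ j) :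
    F.map (K.map h) ≫ g j ≫ G.map (subι cB B hj) = g i ≫ G.map (subι cB B hi) := by
  obtain ⟨a, b, hab⟩ := hg i j h
  rw [← subι_w cB B hi hk a, ← subι_w cB B hj hk b, G.map_comp, G.map_comp, reassoc_of% hab]

/-- The structure morphism on the colimit over `B` with components `g`. -/
def subStr (hcB : ∀ B, IsColimit (F.mapCocone (cB B).cocone)) {s : I → I} {t : I → I → I}
    (g : ∀ i, F.obj (K.obj i) ⟶ G.obj (K.obj (s i)))
    (hg : ∀ i j (h : i ⟶ j), ∃ (a : s i ⟶ t i j) (b : s j ⟶ t i j),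
        g i ≫ G.map (K.map a) = F.map (K.map h) ≫ g j ≫ G.map (K.map b))
    (hs : ∀ B : 𝒢, ∀ i ∈ B.1, s i ∈ B.1) (ht : ∀ B : 𝒢, ∀ i ∈ B.1, ∀ j ∈ B.1, t i j ∈ B.1)
    (B : 𝒢) : F.obj (cB B).cocone.pt ⟶ G.obj (cB B).cocone.pt :=
  (hcB B).desc
    { pt := G.obj (cB B).cocone.pt
      ι :=
        { app i := g i.1 ≫ G.map (subι cB B (hs B _ i.2))
          naturality i j h :=
            (map_comp_components hg B (hs B _ i.2) (hs B _ j.2) (ht B _ i.2 _ j.2)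
              ((Subtype.mono_coe (· ∈ B.1)).functor.map h)).trans (Category.comp_id _).symm } }

variable {hcB : ∀ B, IsColimit (F.mapCocone (cB B).cocone)} {s : I → I} {t : I → I → I}
  {g : ∀ i, F.obj (K.obj i) ⟶ G.obj (K.obj (s i))}
  (hg : ∀ i j (h : i ⟶ j), ∃ (a : s i ⟶ t i j) (b : s j ⟶ t i j),
        g i ≫ G.map (K.map a) = F.map (K.map h) ≫ g j ≫ G.map (K.map b))
  (hs : ∀ B : 𝒢, ∀ i ∈ B.1, s i ∈ B.1) (ht : ∀ B : 𝒢, ∀ i ∈ B.1, ∀ j ∈ B.1, t i j ∈ B.1)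

theorem map_subι_subStr {B : 𝒢} {i : I} (hi : i ∈ B.1) :
    F.map (subι cB B hi) ≫ subStr hcB g hg hs ht B = g i ≫ G.map (subι cB B (hs B _ hi)) :=
  (hcB B).fac _ ⟨i, hi⟩

/-- The images under `F` of the coprojections are jointly epic. This handles both the transition
morphisms and the cocone legs. -/
theorem subStr_comp {B : 𝒢} {Z : C} {f : F.obj Z ⟶ G.obj Z} {d : (cB B).cocone.pt ⟶ Z}
    (hd : ∀ i (hi : i ∈ B.1), g i ≫ G.map (subι cB B (hs B _ hi) ≫ d) =
      F.map (subι cB B hi ≫ d) ≫ f) :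
    subStr hcB g hg hs ht B ≫ G.map d = F.map d ≫ f :=
  (hcB B).hom_ext fun i => by
    change F.map (subι cB B i.2) ≫ _ ≫ _ = F.map (subι cB B i.2) ≫ _ ≫ _
    rw [← Category.assoc, map_subι_subStr, Category.assoc, ← G.map_comp, ← F.map_comp_assoc,
      hd _ i.2]

/-- The functor sending a subset in `𝒢` to the colimit over it with the structure morphism
`subStr`. -/
def subInsFunctor (hcB : ∀ B, IsColimit (F.mapCocone (cB B).cocone)) : 𝒢 ⥤ Ins F G where
  obj B := ⟨(subFunctor cB).obj B, subStr hcB g hg hs ht B⟩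
  map {B B'} h := homMk ((subFunctor cB).map h) (subStr_comp hg hs ht fun i hi => by
    rw [subι_map cB h, subι_map cB h, map_subι_subStr])
  map_id B := hom_ext' ((subFunctor cB).map_id B)
  map_comp f f' := hom_ext' ((subFunctor cB).map_comp f f')

/-- The canonical cocone over `subInsFunctor`. -/
def subInsCocone (c : Cocone K) {f : F.obj c.pt ⟶ G.obj c.pt}
    (hf : ∀ i, g i ≫ G.map (c.ι.app (s i)) = F.map (c.ι.app i) ≫ f) :
    Cocone (subInsFunctor hg hs ht hcB) where
  pt := ⟨c.pt, f⟩
  ι :=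
    { app B := homMk (B := ⟨c.pt, f⟩) ((subCocone cB c).ι.app B) (subStr_comp hg hs ht fun i hi =>
        (congr_arg (g i ≫ G.map ·) (subι_subCocone cB c (hs B i hi))).trans
          ((hf i).trans (congr_arg (F.map · ≫ f) (subι_subCocone cB c hi).symm)))
      naturality _ _ h := hom_ext' ((subCocone cB c).ι.naturality h) }

end

theorem isAccessibleCategory [IsAccessibleCategory.{w} C] [IsAccessibleCategory.{w} D]
    (hC : HasDirectedColimits.{w} C) (hF : PreservesDirectedColimits.{w} F)
    (hG : PreservesDirectedColimits.{w} G) : IsAccessibleCategory.{w} (Ins F G) := by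
  obtain ⟨μ₀, hμ₀⟩ := exists_presentableWithImage_generator hC hF
  obtain ⟨μ, hμr, hle⟩ := exists_regular_ge μ₀
  have : Fact μ.IsRegular := ⟨hμr⟩
  obtain ⟨hμ, _, hR⟩ := hμ₀ μ hle
  have : ObjectProperty.EssentiallySmall.{w} (presentableWithImage F μ) :=
    .of_le (Q := CategoryTheory.isCardinalPresentable C μ) inf_le_left
  have := locallySmall_of_isAccessibleCategory.{w} D
  have : LocallySmall.{w} (Ins F G) := locallySmall_of_faithful (proj F G)
  have : ObjectProperty.EssentiallySmall.{w}
      ((presentableWithImage F μ).inverseImage (proj F G)) :=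
    essentiallySmall_inverseImage_proj _
  have hgen : ((presentableWithImage F μ).inverseImage (proj F G)).IsCardinalFilteredGenerator μ :=
    { le_isCardinalPresentable A hA := isCardinalPresentable hC hF hG hA
      exists_colimitsOfShape X := by
        obtain ⟨I, _, _, _, _, ⟨p⟩⟩ := exists_directed_colimitOfShape hR X.base
        obtain ⟨u, hu⟩ := exists_upperBound (I := I)
        have := hG I
        obtain ⟨s, g, t, hf, hg⟩ := exists_components (μ := μ) p.isColimit
          (fun i => (p.prop_diag_obj i).2) X.str
        -- Closure under `u` gives directedness, under `s` the components of the structure morphism,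
        -- and under `t` their compatibility. The unary `s` is encoded as a binary operation
        -- ignoring its second argument.
        let ops : Set (I → I → I) := {u, t, fun i _ => s i}
        have huo : u ∈ ops := Or.inl rfl
        have hops : ops.Finite := Set.toFinite _
        let cB := subColimits hC p.diag (μ := μ) hu huo
        have hcB (B : closedSubsets μ ops) : IsColimit (F.mapCocone (cB B).cocone) :=
          have := isDirectedOrder_of_mem_closedSubsets hu huo B.2
          have := B.2.1.to_subtype
          have := hF B.1
          isColimitOfPreserves F (cB B).isColimit
        have hs (B : closedSubsets μ ops) (i : I) (hi : i ∈ B.1) : s i ∈ B.1 :=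
          B.2.2.2 (fun i _ => s i) (Or.inr (Or.inr rfl)) i hi i hi
        have ht (B : closedSubsets μ ops) : ∀ i ∈ B.1, ∀ j ∈ B.1, t i j ∈ B.1 :=
          B.2.2.2 t (Or.inr (Or.inl rfl))
        have := isCardinalFiltered_closedSubsets hμ hops
        have := isFiltered_of_isCardinalFiltered (closedSubsets μ ops) μ
        have := hF.preservesColimitsOfShape (closedSubsets μ ops)
        refine ⟨closedSubsets μ ops, inferInstance, inferInstance,
          ⟨{  diag := subInsFunctor hg hs ht hcB
              ι := (subInsCocone (hcB := hcB) hg hs ht p.cocone hf).ι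
              -- On bases this is the decomposition of `X.base` into subcolimits, and `F` preserves
              -- that filtered colimit.
              isColimit := isColimitOfProj (isColimitClosedSubsets hμ hops cB p.isColimit)
              prop_diag_obj B := directedColimits_presentableWithImage_le hF μ _
                (directedColimits_subColimits p.prop_diag_obj hu huo cB B) }⟩⟩ }
  have := hgen.hasCardinalFilteredGenerator
  have := (hasDirectedColimits (G := G) hC hF).hasCardinalFilteredColimits μ
  exact ⟨μ, inferInstance, { }⟩

end Ins

/-! ### Equifiers of accessible categories with directed colimits -/

namespace Eqf

variable {C : Type u₁} [Category.{v₁} C] {D : Type u₂} [Category.{v₂} D] {F G : C ⥤ D}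
  (φ ψ : F ⟶ G)

theorem app_eq_of_isColimit {J : Type*} [Category* J] {K : J ⥤ C} {c : Cocone K}
    (hc : IsColimit (F.mapCocone c))
    (h : ∀ j, F.map (c.ι.app j) ≫ φ.app c.pt = F.map (c.ι.app j) ≫ ψ.app c.pt) :
    φ.app c.pt = ψ.app c.pt :=
  hc.hom_ext h

theorem isClosedUnderColimitsOfShape (J : Type*) [Category* J] [PreservesColimitsOfShape J F] :
    ObjectProperty.IsClosedUnderColimitsOfShape (fun X : C => φ.app X = ψ.app X) J where
  colimitsOfShape_le := by
    rintro X ⟨p⟩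
    refine app_eq_of_isColimit φ ψ (isColimitOfPreserves F p.isColimit) fun j => ?_
    exact (φ.naturality (p.ι.app j)).trans ((congr_arg (· ≫ G.map (p.ι.app j))
      (p.prop_diag_obj j)).trans (ψ.naturality (p.ι.app j)).symm)

theorem preservesColimitsOfShape_incl (J : Type*) [Category* J] [HasColimitsOfShape J C]
    [PreservesColimitsOfShape J F] : PreservesColimitsOfShape J (incl φ ψ) := by
  have := isClosedUnderColimitsOfShape φ ψ J
  infer_instance

variable {φ ψ} in
theorem preservesColimitsOfShape_of_incl {T : Type*} [Category* T] {h : T ⥤ Eqf φ ψ} (J : Type*)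
    [Category* J] (hh : PreservesColimitsOfShape J (h ⋙ incl φ ψ)) : PreservesColimitsOfShape J h :=
  preservesColimitsOfShape_of_reflects_of_preserves h (incl φ ψ)

theorem hasDirectedColimits (hC : HasDirectedColimits.{w} C)
    (hF : PreservesDirectedColimits.{w} F) : HasDirectedColimits.{w} (Eqf φ ψ) := fun J _ _ _ =>
  have := hC J
  have := hF J
  have := isClosedUnderColimitsOfShape φ ψ J
  hasColimitsOfShape_of_closedUnderColimits J _

theorem preservesDirectedColimits_incl (hC : HasDirectedColimits.{w} C)
    (hF : PreservesDirectedColimits.{w} F) : PreservesDirectedColimits.{w} (incl φ ψ) :=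
  fun J _ _ _ =>
  have := hC J
  have := hF J
  preservesColimitsOfShape_incl φ ψ J

theorem isCardinalPresentable (hC : HasDirectedColimits.{w} C)
    (hF : PreservesDirectedColimits.{w} F) {μ : Cardinal.{w}} [Fact μ.IsRegular] {A : Eqf φ ψ}
    [IsCardinalPresentable A.obj μ] : IsCardinalPresentable A μ := by
  have := (preservesDirectedColimits_incl φ ψ hC hF).isCardinalAccessible μ
  refine isCardinalPresentable_of_exists (fun J _ _ K c hc f => ?_) fun J _ _ K c hc j f g h => ?_
  · have := (incl φ ψ).preservesColimitsOfShape_of_isCardinalAccessible μ J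
    obtain ⟨j, g, hg⟩ := IsCardinalPresentable.exists_hom_of_isColimit μ
      (isColimitOfPreserves (incl φ ψ) hc) (X := A.obj) f.hom
    exact ⟨j, ObjectProperty.homMk g, ObjectProperty.hom_ext _ hg⟩
  · have := (incl φ ψ).preservesColimitsOfShape_of_isCardinalAccessible μ J
    obtain ⟨k, a, ha⟩ := IsCardinalPresentable.exists_eq_of_isColimit' μ
      (isColimitOfPreserves (incl φ ψ) hc) (X := A.obj) f.hom g.hom
      (congr_arg (incl φ ψ).map h)
    exact ⟨k, a, ObjectProperty.hom_ext _ ha⟩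

variable {φ ψ} in
theorem essentiallySmall_inverseImage_incl (P : ObjectProperty C)
    [ObjectProperty.EssentiallySmall.{w} P] :
    ObjectProperty.EssentiallySmall.{w} (P.inverseImage (incl φ ψ)) := by
  obtain ⟨Q, _, -, hQ⟩ := ObjectProperty.EssentiallySmall.exists_small_le P
  let X (x : { a : Subtype Q // φ.app a.1 = ψ.app a.1 }) : Eqf φ ψ := ⟨x.1.1, x.2⟩
  refine ⟨.ofObj X, inferInstance, fun A hA => ?_⟩
  obtain ⟨a, ha, ⟨e⟩⟩ := hQ _ hA
  change A.obj ≅ a at e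
  -- By naturality, agreement of the transformations passes along the isomorphism `e`.
  have hφ : φ.app a = ψ.app a := by
    rw [← cancel_epi (F.map e.hom), φ.naturality, ψ.naturality, A.property]
  exact ⟨_, ObjectProperty.ofObj_apply X ⟨⟨a, ha⟩, hφ⟩,
    ⟨ObjectProperty.isoMk _ (X := A) (Y := ⟨a, hφ⟩) e⟩⟩

section

variable {I : Type w} [PartialOrder I] {K : I ⥤ C}

/-- By naturality the two components at `K.obj i` become equal in `G.obj c.pt`; presentability of
`F.obj (K.obj i)` moves the equality to a stage `s i`. -/
theorem exists_app_comp_eq {μ : Cardinal.{w}} [Fact μ.IsRegular] [IsCardinalFiltered I μ]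
    {c : Cocone K} (hc : IsColimit c) [PreservesColimitsOfShape I G]
    (hK : ∀ i, IsCardinalPresentable (F.obj (K.obj i)) μ) (h : φ.app c.pt = ψ.app c.pt) :
    ∃ s : I → I, ∀ i, ∃ a : i ⟶ s i,
      φ.app (K.obj i) ≫ G.map (K.map a) = ψ.app (K.obj i) ≫ G.map (K.map a) := by
  choose s a ha using fun i => IsCardinalPresentable.exists_eq_of_isColimit' μ
    (isColimitOfPreserves G hc) (φ.app (K.obj i)) (ψ.app (K.obj i)) (by
      change _ ≫ G.map (c.ι.app i) = _ ≫ G.map (c.ι.app i)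
      rw [← φ.naturality, ← ψ.naturality]
      exact congr_arg _ h)
  exact ⟨s, fun i => ⟨a i, ha i⟩⟩

/-- Closure under `s` keeps the stage at which the components agree inside `B`, so they agree on
every leg of the colimit preserved by `F`. -/
theorem app_eq_of_closed {𝒢 : Set (Set I)} {cB : ∀ B : 𝒢, ColimitCocone (resDiagram K B.1)}
    {B : 𝒢} (hcB : IsColimit (F.mapCocone (cB B).cocone)) {s : I → I}
    (hs : ∀ i, ∃ a : i ⟶ s i,
      φ.app (K.obj i) ≫ G.map (K.map a) = ψ.app (K.obj i) ≫ G.map (K.map a))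
    (hB : ∀ i ∈ B.1, s i ∈ B.1) : φ.app (cB B).cocone.pt = ψ.app (cB B).cocone.pt := by
  refine app_eq_of_isColimit φ ψ hcB fun i => ?_
  obtain ⟨a, ha⟩ := hs i.1
  change F.map (subι cB B i.2) ≫ _ = F.map (subι cB B i.2) ≫ _
  rw [φ.naturality, ψ.naturality, ← subι_w cB B i.2 (hB _ i.2) a, G.map_comp, reassoc_of% ha]

end

theorem isAccessibleCategory [IsAccessibleCategory.{w} C] [IsAccessibleCategory.{w} D]
    (hC : HasDirectedColimits.{w} C) (hF : PreservesDirectedColimits.{w} F)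
    (hG : PreservesDirectedColimits.{w} G) : IsAccessibleCategory.{w} (Eqf φ ψ) := by
  obtain ⟨μ₀, hμ₀⟩ := exists_presentableWithImage_generator hC hF
  obtain ⟨μ, hμr, hle⟩ := exists_regular_ge μ₀
  have : Fact μ.IsRegular := ⟨hμr⟩
  obtain ⟨hμ, _, hR⟩ := hμ₀ μ hle
  have : ObjectProperty.EssentiallySmall.{w} (presentableWithImage F μ) :=
    .of_le (Q := CategoryTheory.isCardinalPresentable C μ) inf_le_left
  have := locallySmall_of_isAccessibleCategory.{w} D
  have : LocallySmall.{w} (Eqf φ ψ) := locallySmall_of_faithful (incl φ ψ)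
  have : ObjectProperty.EssentiallySmall.{w}
      ((presentableWithImage F μ).inverseImage (incl φ ψ)) :=
    essentiallySmall_inverseImage_incl _
  have hgen : ((presentableWithImage F μ).inverseImage
      (incl φ ψ)).IsCardinalFilteredGenerator μ :=
    { le_isCardinalPresentable A hA :=
        have : IsCardinalPresentable A.obj μ := hA.1
        isCardinalPresentable φ ψ hC hF
      exists_colimitsOfShape X := by
        obtain ⟨I, _, _, _, _, ⟨p⟩⟩ := exists_directed_colimitOfShape hR X.obj
        obtain ⟨u, hu⟩ := exists_upperBound (I := I)
        have := hG I
        obtain ⟨s, hs⟩ := exists_app_comp_eq (μ := μ) φ ψ p.isColimit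
          (fun i => (p.prop_diag_obj i).2) X.property
        -- There is no structure to build on a subcolimit, only an equality to verify, so no
        -- compatibility operation `t` is needed.
        let ops : Set (I → I → I) := {u, fun i _ => s i}
        have huo : u ∈ ops := Or.inl rfl
        have hops : ops.Finite := Set.toFinite _
        let cB := subColimits hC p.diag (μ := μ) hu huo
        have hcB (B : closedSubsets μ ops) : φ.app (cB B).cocone.pt = ψ.app (cB B).cocone.pt :=
          have := isDirectedOrder_of_mem_closedSubsets hu huo B.2
          have := B.2.1.to_subtype
          have := hF B.1
          app_eq_of_closed φ ψ (isColimitOfPreserves F (cB B).isColimit) hs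
            fun i hi => B.2.2.2 (fun i _ => s i) (Or.inr rfl) i hi i hi
        exact ⟨closedSubsets μ ops, inferInstance, isCardinalFiltered_closedSubsets hμ hops,
          ⟨{  diag := ObjectProperty.lift _ (subFunctor cB) hcB
              ι :=
                { app B := ObjectProperty.homMk ((subCocone cB p.cocone).ι.app B)
                  naturality _ _ h :=
                    ObjectProperty.hom_ext _ ((subCocone cB p.cocone).ι.naturality h) }
              isColimit := isColimitOfReflects (incl φ ψ)
                (isColimitClosedSubsets hμ hops cB p.isColimit)
              prop_diag_obj B := directedColimits_presentableWithImage_le hF μ _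
                (directedColimits_subColimits p.prop_diag_obj hu huo cB B) }⟩⟩ }
  have := hgen.hasCardinalFilteredGenerator
  have := (hasDirectedColimits φ ψ hC hF).hasCardinalFilteredColimits μ
  exact ⟨μ, inferInstance, { }⟩

end Eqf

/-! ### The 2-categories of accessible categories -/

theorem acc₀_isContainedIn_acc : Acc₀.{w}.IsContainedIn Acc.{w} :=
  ⟨fun _ h => h.1, fun _ _ _ _ _ h => h.isAccessible⟩

/-- An isomorphism in `CAT` is an equivalence, which transports accessibility and directed colimits
and preserves colimits in both directions. -/
theorem acc₀_isReplete_acc : Acc₀.{w}.IsReplete Acc.{w} := by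
  intro P Q e e' _ _ h h' hQ
  let E : CategoryTheory.Equivalence P Q := Cat.equivOfIso ⟨e, e', h, h'⟩
  have := hQ.1
  exact ⟨⟨E.symm.isAccessibleCategory, fun J _ _ _ =>
      have := hQ.2 J
      Adjunction.hasColimitsOfShape_of_equivalence E.functor⟩,
    fun J _ _ _ => inferInstanceAs (PreservesColimitsOfShape J E.functor),
    fun J _ _ _ => inferInstanceAs (PreservesColimitsOfShape J E.inverse)⟩

/-! #### Products -/

section

variable {I : Type w} {K : I → CAT.{w}}

theorem acc₀_obj_prodCat (hK : ∀ i, Acc₀.{w}.obj (K i)) : Acc₀.{w}.obj (prodCat K) :=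
  have := fun i => (hK i).1
  ⟨PiCat.isAccessibleCategory (K := fun i => (K i : Type (w + 1))) fun i => (hK i).2,
    PiCat.hasDirectedColimits (K := fun i => (K i : Type (w + 1))) fun i => (hK i).2⟩

theorem acc₀_hom_prodProj (hK : ∀ i, Acc₀.{w}.obj (K i)) (i : I) : Acc₀.{w}.hom (prodProj K i) :=
  PiCat.preservesDirectedColimits_eval (K := fun i => (K i : Type (w + 1))) (fun i => (hK i).2) i

theorem isProduct_acc (hK : ∀ i, Acc₀.{w}.obj (K i)) :
    Acc.{w}.IsProduct K (prodCat K) (prodProj K) :=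
  (isProduct_prodCat K).of_isContainedIn (Sub2Cat.whole_contains _) (fun i => (hK i).1)
    (acc₀_obj_prodCat hK).1 (fun i => (acc₀_hom_prodProj hK i).isAccessible) fun _ _ _ _ h =>
      PiCat.isAccessible_of_eval (K := fun i => (K i : Type (w + 1))) h

theorem isProduct_acc₀ (hK : ∀ i, Acc₀.{w}.obj (K i)) :
    Acc₀.{w}.IsProduct K (prodCat K) (prodProj K) :=
  (isProduct_prodCat K).of_isContainedIn (Sub2Cat.whole_contains _) hK
    (acc₀_obj_prodCat hK) (acc₀_hom_prodProj hK) fun _ _ _ _ h J _ _ _ =>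
      PiCat.preservesColimitsOfShape_of_eval (K := fun i => (K i : Type (w + 1))) fun i => h i J

end

/-! #### Inserters and equifiers -/

section

variable {X Y : CAT.{w}} {F G : X ⟶ Y}

theorem acc₀_obj_insCat (hX : Acc₀.{w}.obj X) (hY : Acc₀.{w}.obj Y)
    (hF : Acc₀.{w}.hom F) (hG : Acc₀.{w}.hom G) : Acc₀.{w}.obj (insCat F G) :=
  have := hX.1
  have := hY.1
  ⟨Ins.isAccessibleCategory hX.2 hF hG, Ins.hasDirectedColimits hX.2 hF⟩

theorem acc₀_hom_insProj (hX : Acc₀.{w}.obj X) (hF : Acc₀.{w}.hom F) : Acc₀.{w}.hom (insProj F G) :=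
  Ins.preservesDirectedColimits_proj G.toFunctor hX.2 hF

/-- The index `κ` of the composite also serves `h`: `F` preserves all `κ`-filtered colimits, so the
projection reflects them. -/
theorem acc_hom_of_comp_insProj (hF : Acc₀.{w}.hom F) {Z : CAT.{w}} {h : Z ⟶ insCat F G}
    (hh : Acc.{w}.hom (h ≫ insProj F G)) : Acc.{w}.hom h := by
  obtain ⟨κ, _, _⟩ := hh
  refine ⟨κ, inferInstance, ⟨fun J _ _ => ?_⟩⟩
  have := isFiltered_of_isCardinalFiltered J κ
  have := hF.preservesColimitsOfShape J
  exact Ins.preservesColimitsOfShape_of_proj (F := F.toFunctor) (G := G.toFunctor)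
    ((h ≫ insProj F G).toFunctor.preservesColimitsOfShape_of_isCardinalAccessible κ J)

theorem acc₀_hom_of_comp_insProj (hF : Acc₀.{w}.hom F) {Z : CAT.{w}} {h : Z ⟶ insCat F G}
    (hh : Acc₀.{w}.hom (h ≫ insProj F G)) : Acc₀.{w}.hom h := fun J _ _ _ =>
  have := hF J
  Ins.preservesColimitsOfShape_of_proj (F := F.toFunctor) (G := G.toFunctor) (hh J)

theorem isInserter_acc (hX : Acc₀.{w}.obj X) (hY : Acc₀.{w}.obj Y)
    (hF : Acc₀.{w}.hom F) (hG : Acc₀.{w}.hom G) :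
    Acc.{w}.IsInserter F G (insCat F G) (insProj F G) (insCell F G) :=
  (isInserter_insCat F G).of_isContainedIn (Sub2Cat.whole_contains _) hX.1
    (acc₀_obj_insCat hX hY hF hG).1 (acc₀_hom_insProj hX hF).isAccessible
    fun _ _ _ _ => acc_hom_of_comp_insProj hF

theorem isInserter_acc₀ (hX : Acc₀.{w}.obj X) (hY : Acc₀.{w}.obj Y)
    (hF : Acc₀.{w}.hom F) (hG : Acc₀.{w}.hom G) :
    Acc₀.{w}.IsInserter F G (insCat F G) (insProj F G) (insCell F G) :=
  (isInserter_insCat F G).of_isContainedIn (Sub2Cat.whole_contains _) hX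
    (acc₀_obj_insCat hX hY hF hG) (acc₀_hom_insProj hX hF)
    fun _ _ _ _ => acc₀_hom_of_comp_insProj hF

theorem acc₀_obj_eqfCat (hX : Acc₀.{w}.obj X) (hY : Acc₀.{w}.obj Y)
    (hF : Acc₀.{w}.hom F) (hG : Acc₀.{w}.hom G) (φ ψ : F ⟶ G) :
    Acc₀.{w}.obj (eqfCat φ ψ) :=
  have := hX.1
  have := hY.1
  ⟨Eqf.isAccessibleCategory _ _ hX.2 hF hG, Eqf.hasDirectedColimits _ _ hX.2 hF⟩

theorem acc₀_hom_eqfIncl (hX : Acc₀.{w}.obj X) (hF : Acc₀.{w}.hom F) (φ ψ : F ⟶ G) :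
    Acc₀.{w}.hom (eqfIncl φ ψ) :=
  Eqf.preservesDirectedColimits_incl _ _ hX.2 hF

/-- A fully faithful inclusion reflects all colimits, so the index of the composite is kept. -/
theorem acc_hom_of_comp_eqfIncl {φ ψ : F ⟶ G} {Z : CAT.{w}} {h : Z ⟶ eqfCat φ ψ}
    (hh : Acc.{w}.hom (h ≫ eqfIncl φ ψ)) : Acc.{w}.hom h := by
  obtain ⟨κ, _, _⟩ := hh
  refine ⟨κ, inferInstance, ⟨fun J _ _ => ?_⟩⟩
  exact Eqf.preservesColimitsOfShape_of_incl (φ := φ.toNatTrans) (ψ := ψ.toNatTrans) J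
    ((h ≫ eqfIncl φ ψ).toFunctor.preservesColimitsOfShape_of_isCardinalAccessible κ J)

theorem acc₀_hom_of_comp_eqfIncl {φ ψ : F ⟶ G} {Z : CAT.{w}} {h : Z ⟶ eqfCat φ ψ}
    (hh : Acc₀.{w}.hom (h ≫ eqfIncl φ ψ)) : Acc₀.{w}.hom h := fun J _ _ _ =>
  Eqf.preservesColimitsOfShape_of_incl (φ := φ.toNatTrans) (ψ := ψ.toNatTrans) J (hh J)

theorem isEquifier_acc (hX : Acc₀.{w}.obj X) (hY : Acc₀.{w}.obj Y)
    (hF : Acc₀.{w}.hom F) (hG : Acc₀.{w}.hom G) (φ ψ : F ⟶ G) :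
    Acc.{w}.IsEquifier φ ψ (eqfCat φ ψ) (eqfIncl φ ψ) :=
  (isEquifier_eqfCat φ ψ).of_isContainedIn (Sub2Cat.whole_contains _) hX.1
    (acc₀_obj_eqfCat hX hY hF hG φ ψ).1 (acc₀_hom_eqfIncl hX hF φ ψ).isAccessible
    fun _ _ _ _ => acc_hom_of_comp_eqfIncl

theorem isEquifier_acc₀ (hX : Acc₀.{w}.obj X) (hY : Acc₀.{w}.obj Y)
    (hF : Acc₀.{w}.hom F) (hG : Acc₀.{w}.hom G) (φ ψ : F ⟶ G) :
    Acc₀.{w}.IsEquifier φ ψ (eqfCat φ ψ) (eqfIncl φ ψ) :=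
  (isEquifier_eqfCat φ ψ).of_isContainedIn (Sub2Cat.whole_contains _) hX
    (acc₀_obj_eqfCat hX hY hF hG φ ψ) (acc₀_hom_eqfIncl hX hF φ ψ)
    fun _ _ _ _ => acc₀_hom_of_comp_eqfIncl

end

theorem acc₀_closedUnderPIELimits : Sub2Cat.ClosedUnderPIELimits.{w} Acc₀.{w} Acc.{w} :=
  have hc := acc₀_isContainedIn_acc
  have hr := acc₀_isReplete_acc
  ⟨hc,
    fun _ _ hK => ⟨⟨_, _, isProduct_acc hK⟩, fun _ _ hP =>
      hP.of_isReplete hc hr hK (isProduct_acc hK) (isProduct_acc₀ hK)⟩,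
    fun _ _ _ _ hX hY hF hG => ⟨⟨_, _, _, isInserter_acc hX hY hF hG⟩, fun _ _ _ hP =>
      hP.of_isReplete hc hr hX (isInserter_acc hX hY hF hG) (isInserter_acc₀ hX hY hF hG)⟩,
    fun _ _ _ _ φ ψ hX hY hF hG => ⟨⟨_, _, isEquifier_acc hX hY hF hG φ ψ⟩, fun _ _ hP =>
      hP.of_isReplete hc hr hX (isEquifier_acc hX hY hF hG φ ψ)
        (isEquifier_acc₀ hX hY hF hG φ ψ)⟩⟩

end PIE

theorem theorem2p2 :
    -- `Acc₀` is closed under PIE-limits in `Acc`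
    PIE.Sub2Cat.ClosedUnderPIELimits.{w} PIE.Acc₀.{w} PIE.Acc.{w} ∧
    -- and these limits are computed in the 2-category of all categories:
    -- product categories are products there, in `Acc` and in `Acc₀`;
    (∀ (I : Type w) (K : I → PIE.CAT.{w}), (∀ i, PIE.Acc₀.{w}.obj (K i)) →
      (PIE.Sub2Cat.whole _).IsProduct K (PIE.prodCat K) (PIE.prodProj K) ∧
      PIE.Acc.{w}.IsProduct K (PIE.prodCat K) (PIE.prodProj K) ∧
      PIE.Acc₀.{w}.IsProduct K (PIE.prodCat K) (PIE.prodProj K)) ∧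
    -- so are inserter categories
    (∀ (X Y : PIE.CAT.{w}) (F G : X ⟶ Y), PIE.Acc₀.{w}.obj X → PIE.Acc₀.{w}.obj Y →
      PIE.Acc₀.{w}.hom F → PIE.Acc₀.{w}.hom G →
      (PIE.Sub2Cat.whole _).IsInserter F G (PIE.insCat F G) (PIE.insProj F G) (PIE.insCell F G) ∧
      PIE.Acc.{w}.IsInserter F G (PIE.insCat F G) (PIE.insProj F G) (PIE.insCell F G) ∧
      PIE.Acc₀.{w}.IsInserter F G (PIE.insCat F G) (PIE.insProj F G) (PIE.insCell F G)) ∧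
    -- and equifier categories
    (∀ (X Y : PIE.CAT.{w}) (F G : X ⟶ Y) (φ ψ : F ⟶ G),
      PIE.Acc₀.{w}.obj X → PIE.Acc₀.{w}.obj Y → PIE.Acc₀.{w}.hom F → PIE.Acc₀.{w}.hom G →
      (PIE.Sub2Cat.whole _).IsEquifier φ ψ (PIE.eqfCat φ ψ) (PIE.eqfIncl φ ψ) ∧
      PIE.Acc.{w}.IsEquifier φ ψ (PIE.eqfCat φ ψ) (PIE.eqfIncl φ ψ) ∧
      PIE.Acc₀.{w}.IsEquifier φ ψ (PIE.eqfCat φ ψ) (PIE.eqfIncl φ ψ)) :=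
  ⟨PIE.acc₀_closedUnderPIELimits,
    fun _ K hK => ⟨PIE.isProduct_prodCat K, PIE.isProduct_acc hK, PIE.isProduct_acc₀ hK⟩,
    fun _ _ F G hX hY hF hG => ⟨PIE.isInserter_insCat F G, PIE.isInserter_acc hX hY hF hG,
      PIE.isInserter_acc₀ hX hY hF hG⟩,
    fun _ _ _ _ φ ψ hX hY hF hG => ⟨PIE.isEquifier_eqfCat φ ψ,
      PIE.isEquifier_acc hX hY hF hG φ ψ, PIE.isEquifier_acc₀ hX hY hF hG φ ψ⟩⟩
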